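/- For a topological space $X$ let $w(X)$ denote its weight, the least cardinality of a base of the topology of $X$. For a metric space $M$ let $\mathrm{Iso}(M)$ be the group of all isometries of $M$ onto itself under composition, with the topology of pointwise convergence. A metric space $M$ is $\omega$-homogeneous if every isometry $f:A\to B$ between finite subsets $A,B$ of $M$ extends to an isometry of $M$ onto itself. A metric space $M$ is Urysohn if its diameter equals $1$ and, for every finite metric space $L$ of diameter at most $1$ and every subset $K\subset L$, every isometric embedding $K\to M$ extends to an isometric embedding $L\to M$. Theorem. For every Hausdorff topological group $G$ there exists a complete $\omega$-homogeneous Urysohn metric space $M$ such that $G$ is isomorphic, as a topological group, to a topological subgroup of $\mathrm{Iso}(M)$, and such that $w(M)=w(G)$ if $G$ is infinite and $w(M)=\aleph_0$ if $G$ is finite. -/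

import Mathlib

open Topology Cardinal

universe u

/-- The weight `w(X)`: the least cardinality of a base of the topology of `X`. -/
noncomputable def weight (X : Type u) [TopologicalSpace X] : Cardinal.{u} :=
  sInf {c : Cardinal.{u} | ∃ B : Set (Set X), TopologicalSpace.IsTopologicalBasis B ∧ #B = c}

/-- The topology of pointwise convergence on the group `Iso(M) = (M ≃ᵢ M)` of all isometries of
`M` onto itself (the group operation is composition): the one induced from the product `M → M`. -/
instance isoTopology (M : Type u) [MetricSpace M] : TopologicalSpace (M ≃ᵢ M) :=
  TopologicalSpace.induced (fun (g : M ≃ᵢ M) (x : M) => g x) Pi.topologicalSpace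

/-- `M` is `ω`-homogeneous: every isometry between finite subsets of `M` extends to an isometry
of `M` onto itself. -/
def IsOmegaHomogeneous (M : Type u) [MetricSpace M] : Prop :=
  ∀ (A B : Set M), A.Finite → B.Finite → ∀ f : A ≃ᵢ B, ∃ g : M ≃ᵢ M, ∀ a : A, g a = f a

/-- `M` is finitely injective with respect to spaces of diameter at most `1`: for every finite
metric space `L` of diameter at most `1`, every isometric embedding into `M` of a subset `K` of `L`
extends to an isometric embedding of `L`. -/
def IsFinitelyInjectiveLeOne (M : Type u) [MetricSpace M] : Prop :=
  ∀ (L : Type u) [MetricSpace L] [Finite L], Metric.diam (Set.univ : Set L) ≤ 1 →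
    ∀ (K : Set L) (f : K → M), Isometry f → ∃ g : L → M, Isometry g ∧ ∀ k : K, g k = f k

/-- `M` is Urysohn: its diameter is equal to `1` and it is finitely injective with respect to
spaces of diameter at most `1`. (`Metric.diam` is `0` on unbounded spaces, so the first condition
includes boundedness.) -/
def IsUrysohn (M : Type u) [MetricSpace M] : Prop :=
  Metric.diam (Set.univ : Set M) = 1 ∧ IsFinitelyInjectiveLeOne M

/-! The group acts isometrically on a seed space of diameter at most 1 whose orbit maps determine
its topology. This space is enlarged to a homogeneous one, with the action extended and the density
kept at most `κ = max (w(G)) ℵ₀`, and is then completed. Density suffices, since it bounds the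
weight of a metric space.

The partial isometries to be extended are points of an index space with its own pseudometric and
`G`-action, subject to the coherence condition: if `i` sends `x` to `y` and `j` sends `x'` to `y'`,
then `dist x x'` and `dist y y'` differ by at most `2 * dist i j`. Metrizing the indices keeps the
density small, makes the action continuous at the added points, and makes the final isometries
depend on their index in a Lipschitz way.

`IsoSystem.forward` freely adds an image `(i, x)` for each index and point. By `dist_toPre_inl` and
`dist_toPre_fibre`, the old space and each fibre `{i} × X` embed isometrically; both follow from
extending Lipschitz functions, for which coherence is the consistency condition. Applying this to
the relations and to their inverses, and adding all pairs of `n`-tuples at stage `n`, makes every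
index a global isometry `T_i` of the union, with `dist (T_i x) (T_j x) ≤ 2 * dist i j`. Then
`T_(u,v) ∘ T_(u,u)⁻¹` sends `u` to `v` and moves no point by more than `2 max dist (u a) (v a)`
(`isUniformlyHomogeneous_limit`).

This control lets homogeneity pass to the completion, by a convergent sequence of approximate
corrections. The seed also contains the finite sequences in `[0, 1]` with the sup distance, hence a
copy of every finite metric space of diameter at most 1; homogeneity moves such copies into place,
which gives the Urysohn property. -/

/-- `Y` has a dense subset of cardinality at most `κ`. -/
def HasDense (κ : Cardinal.{u}) (Y : Type u) [TopologicalSpace Y] : Prop :=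
  ∃ (ι : Type u) (f : ι → Y), #ι ≤ κ ∧ DenseRange f

/-! ### Sup pseudometrics of families of functions, and Lipschitz extension. -/

/-- The pseudometric `sup_i |F i p - F i q|` defined by a family of functions with values in
`[0, 1]`. -/
@[reducible]
noncomputable def familyPseudoMetric {ι P : Type*} (F : ι → P → ℝ)
    (hF : ∀ i p, F i p ∈ Set.Icc (0 : ℝ) 1) : PseudoMetricSpace P where
  dist p q := ⨆ i, |F i p - F i q|
  dist_self p := by simp
  dist_comm p q := by simp only [abs_sub_comm]
  dist_triangle p q r := by
    have bdd : ∀ p q, BddAbove (Set.range fun i => |F i p - F i q|) := fun p q =>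
      ⟨1, by
        rintro _ ⟨i, rfl⟩
        have h1 := hF i p
        have h2 := hF i q
        exact abs_le.2 ⟨by linarith [h1.1, h2.2], by linarith [h1.2, h2.1]⟩⟩
    have nonneg : ∀ p q, 0 ≤ ⨆ i, |F i p - F i q| := fun p q =>
      Real.iSup_nonneg fun i => abs_nonneg _
    refine Real.iSup_le (fun i => ?_) (add_nonneg (nonneg _ _) (nonneg _ _))
    exact (abs_sub_le _ (F i q) _).trans
      (add_le_add (le_ciSup (bdd p q) i) (le_ciSup (bdd q r) i))

/-- The type `P` with the pseudometric defined by a family of functions with values in `[0, 1]`. -/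
def FamilySpace {ι P : Type*} (F : ι → P → ℝ) (_ : ∀ i p, F i p ∈ Set.Icc (0 : ℝ) 1) : Type _ := P

namespace FamilySpace

variable {ι P : Type*} {F : ι → P → ℝ} {hF : ∀ i p, F i p ∈ Set.Icc (0 : ℝ) 1}

noncomputable instance : PseudoMetricSpace (FamilySpace F hF) := familyPseudoMetric F hF

/-- The identity map from `P` to `FamilySpace F hF`. -/
def of (hF : ∀ i p, F i p ∈ Set.Icc (0 : ℝ) 1) (p : P) : FamilySpace F hF := p

lemma abs_sub_le_one (i : ι) (p q : P) (hF : ∀ i p, F i p ∈ Set.Icc (0 : ℝ) 1) :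
    |F i p - F i q| ≤ 1 := by
  have h1 := hF i p
  have h2 := hF i q
  exact abs_le.2 ⟨by linarith [h1.1, h2.2], by linarith [h1.2, h2.1]⟩

lemma abs_sub_le_dist (i : ι) (p q : P) : |F i p - F i q| ≤ dist (of hF p) (of hF q) :=
  le_ciSup (f := fun i => |F i p - F i q|)
    ⟨1, by rintro _ ⟨i, rfl⟩; exact abs_sub_le_one i p q hF⟩ i

lemma dist_le {p q : P} {c : ℝ} (hc : 0 ≤ c) (h : ∀ i, |F i p - F i q| ≤ c) :
    dist (of hF p) (of hF q) ≤ c :=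
  Real.iSup_le h hc

lemma dist_le_one (p q : FamilySpace F hF) : dist p q ≤ 1 :=
  dist_le zero_le_one fun i => abs_sub_le_one i p q hF

lemma dist_le_of_sub_le {p q : P} {c : ℝ} (hc : 0 ≤ c) (h : ∀ i, F i p - F i q ≤ c)
    (h' : ∀ i, F i q - F i p ≤ c) : dist (of hF p) (of hF q) ≤ c :=
  dist_le hc fun i => abs_sub_le_iff.2 ⟨h i, h' i⟩

instance {G : Type*} [Group G] [MulAction G P] : MulAction G (FamilySpace F hF) :=
  inferInstanceAs (MulAction G P)

lemma isIsometricSMul {G : Type*} [Group G] [MulAction G P]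
    (h : ∀ (g : G) (i : ι), ∃ j, ∀ p, F i (g • p) = F j p) :
    IsIsometricSMul G (FamilySpace F hF) := by
  have key : ∀ (g : G) (p q : P), dist (of hF (g • p)) (of hF (g • q)) ≤ dist (of hF p) (of hF q) := by
    intro g p q
    refine dist_le dist_nonneg fun i => ?_
    obtain ⟨j, hj⟩ := h g i
    rw [hj, hj]
    exact abs_sub_le_dist j p q
  refine ⟨fun g => Isometry.of_dist_eq fun (p q : P) => le_antisymm (key g p q) ?_⟩
  have := key g⁻¹ (g • p) (g • q)
  rwa [inv_smul_smul, inv_smul_smul] at this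

end FamilySpace

instance SeparationQuotient.isIsometricSMul {G Y : Type*} [Group G] [PseudoMetricSpace Y]
    [MulAction G Y] [IsIsometricSMul G Y] : IsIsometricSMul G (SeparationQuotient Y) := by
  refine ⟨fun g => Isometry.of_dist_eq fun p q => ?_⟩
  obtain ⟨p, rfl⟩ := SeparationQuotient.surjective_mk p
  obtain ⟨q, rfl⟩ := SeparationQuotient.surjective_mk q
  rw [← SeparationQuotient.mk_smul, ← SeparationQuotient.mk_smul, SeparationQuotient.dist_mk,
    SeparationQuotient.dist_mk, dist_smul]

/-- McShane extension with tolerances: approximately 1-Lipschitz data with values in `[0, 1]` can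
be approximated by a 1-Lipschitz function with values in `[0, 1]`. -/
lemma exists_lipschitz_of_tolerance {Y ι : Type*} [PseudoMetricSpace Y] (y : ι → Y) (a c : ι → ℝ)
    (ha : ∀ t, a t ∈ Set.Icc (0 : ℝ) 1) (hc : ∀ t, 0 ≤ c t)
    (h : ∀ t t', a t - a t' ≤ dist (y t) (y t') + c t + c t') :
    ∃ f : Y → ℝ, (∀ p, f p ∈ Set.Icc (0 : ℝ) 1) ∧ (∀ p q, f p - f q ≤ dist p q) ∧
      ∀ t, |f (y t) - a t| ≤ c t := by
  -- The infimum of these functions is the McShane extension of the upper data `a + c`; the extra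
  -- value `1` at `none` truncates it.
  let φ : Y → Option ι → ℝ := fun p o => o.elim 1 fun t => a t + c t + dist (y t) p
  have hφ0 : ∀ p o, 0 ≤ φ p o := by
    rintro p (_ | t)
    · exact zero_le_one
    · exact add_nonneg (add_nonneg (ha t).1 (hc t)) dist_nonneg
  have bdd : ∀ p, BddBelow (Set.range (φ p)) := fun p => ⟨0, by rintro _ ⟨o, rfl⟩; exact hφ0 p o⟩
  refine ⟨fun p => ⨅ o, φ p o, fun p => ⟨le_ciInf (hφ0 p), ciInf_le (bdd p) none⟩, ?_, ?_⟩
  · intro p q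
    rw [sub_le_iff_le_add, ← sub_le_iff_le_add']
    refine le_ciInf fun o => ?_
    rw [sub_le_iff_le_add']
    refine (ciInf_le (bdd p) o).trans ?_
    rcases o with _ | t
    · exact le_add_of_nonneg_left dist_nonneg
    · change a t + c t + dist (y t) p ≤ dist p q + (a t + c t + dist (y t) q)
      linarith [dist_triangle (y t) q p, dist_comm p q]
  · intro t
    rw [abs_sub_le_iff]
    constructor
    · have : ⨅ o, φ (y t) o ≤ a t + c t + dist (y t) (y t) := ciInf_le (bdd (y t)) (some t)
      rw [dist_self] at this
      linarith
    · rw [sub_le_comm]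
      refine le_ciInf fun o => ?_
      rcases o with _ | t'
      · exact (sub_le_self _ (hc t)).trans (ha t).2
      · change a t - c t ≤ a t' + c t' + dist (y t') (y t)
        linarith [h t t', dist_comm (y t) (y t')]

/-- The 1-Lipschitz extension of 1-Lipschitz data with values in `[0, 1]`. -/
lemma exists_lipschitz_extension {Y ι : Type*} [PseudoMetricSpace Y] (y : ι → Y) (a : ι → ℝ)
    (ha : ∀ t, a t ∈ Set.Icc (0 : ℝ) 1) (h : ∀ t t', a t - a t' ≤ dist (y t) (y t')) :
    ∃ f : Y → ℝ, (∀ p, f p ∈ Set.Icc (0 : ℝ) 1) ∧ (∀ p q, f p - f q ≤ dist p q) ∧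
      ∀ t, f (y t) = a t := by
  obtain ⟨f, h1, h2, h3⟩ := exists_lipschitz_of_tolerance y a (fun _ => 0) ha (fun _ => le_rfl)
    (by simpa using h)
  exact ⟨f, h1, h2, fun t => sub_eq_zero.1 (abs_nonpos_iff.1 (h3 t))⟩

/-! ### Permanence of density bounds. -/

lemma HasDense.map {κ : Cardinal.{u}} {Y Z : Type u} [TopologicalSpace Y] [TopologicalSpace Z]
    (h : HasDense κ Y) {f : Y → Z} (hf : Continuous f) (hd : DenseRange f) : HasDense κ Z := by
  obtain ⟨ι, s, hι, hs⟩ := h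
  exact ⟨ι, f ∘ s, hι, hd.comp hs hf⟩

lemma HasDense.prod {κ : Cardinal.{u}} (hκ : ℵ₀ ≤ κ) {Y Z : Type u} [TopologicalSpace Y]
    [TopologicalSpace Z] (hY : HasDense κ Y) (hZ : HasDense κ Z) : HasDense κ (Y × Z) := by
  obtain ⟨ι, s, hι, hs⟩ := hY
  obtain ⟨ι', s', hι', hs'⟩ := hZ
  refine ⟨ι × ι', Prod.map s s', ?_, hs.prodMap hs'⟩
  rw [mk_prod, lift_id, lift_id]
  exact (mul_le_mul' hι hι').trans (mul_eq_self hκ).le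

lemma HasDense.pi {κ : Cardinal.{u}} (hκ : ℵ₀ ≤ κ) {Y : Type u} [TopologicalSpace Y]
    (hY : HasDense κ Y) (n : ℕ) : HasDense κ (Fin n → Y) := by
  obtain ⟨ι, s, hι, hs⟩ := hY
  refine ⟨Fin n → ι, fun f a => s (f a), ?_, DenseRange.piMap fun _ => hs⟩
  have : #(Fin n → ι) = #ι ^ n := by simp
  rw [this]
  exact (pow_le_pow_left' hι n).trans (power_nat_le hκ)

lemma HasDense.sum {κ : Cardinal.{u}} (hκ : ℵ₀ ≤ κ) {Y Z : Type u} [TopologicalSpace Y]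
    [TopologicalSpace Z] (hY : HasDense κ Y) (hZ : HasDense κ Z) : HasDense κ (Y ⊕ Z) := by
  obtain ⟨ι, s, hι, hs⟩ := hY
  obtain ⟨ι', s', hι', hs'⟩ := hZ
  refine ⟨ι ⊕ ι', Sum.map s s', ?_, ?_⟩
  · rw [mk_sum, lift_id, lift_id]
    exact (add_le_add hι hι').trans (add_eq_self hκ).le
  · rintro (y | z)
    · refine map_mem_closure continuous_inl (hs y) ?_
      rintro _ ⟨i, rfl⟩
      exact ⟨.inl i, rfl⟩
    · refine map_mem_closure continuous_inr (hs' z) ?_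
      rintro _ ⟨i, rfl⟩
      exact ⟨.inr i, rfl⟩

/-! ### Coherent systems of partial isometries. -/

/-- A bounded metric space with an isometric action of `G`, together with an equivariant family of
partial isometries that depends on its index in a Lipschitz way. -/
structure IsoSystem (G : Type u) [Group G] [TopologicalSpace G] (κ : Cardinal.{u}) where
  X : Type u
  Idx : Type u
  [metX : MetricSpace X]
  [metIdx : PseudoMetricSpace Idx]
  [actX : MulAction G X]
  [actIdx : MulAction G Idx]
  [isoX : IsIsometricSMul G X]
  [isoIdx : IsIsometricSMul G Idx]
  dist_le_one : ∀ x y : X, dist x y ≤ 1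
  idx_dist_le_one : ∀ i j : Idx, dist i j ≤ 1
  tendsto_smul : ∀ x : X, Filter.Tendsto (fun g : G => g • x) (𝓝 1) (𝓝 x)
  tendsto_smul_idx : ∀ i : Idx, Filter.Tendsto (fun g : G => g • i) (𝓝 1) (𝓝 i)
  hasDense : HasDense κ X
  hasDense_idx : HasDense κ Idx
  Rel : Idx → X → X → Prop
  -- For `i = j` this says that `Rel i` is a partial isometry, in particular single-valued and
  -- injective.
  rel_coherent : ∀ {i j x y x' y'}, Rel i x y → Rel j x' y' →
    |dist x x' - dist y y'| ≤ 2 * dist i j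
  rel_smul : ∀ (g : G) {i x y}, Rel i x y → Rel (g • i) (g • x) (g • y)

namespace IsoSystem

variable {G : Type u} [Group G] [TopologicalSpace G] {κ : Cardinal.{u}}

attribute [instance] metX metIdx actX actIdx isoX isoIdx

/-- An embedding of systems. -/
structure Hom (S S' : IsoSystem G κ) where
  toFun : S.X → S'.X
  idxMap : S.Idx → S'.Idx
  isometry : Isometry toFun
  idx_isometry : Isometry idxMap
  map_smul : ∀ (g : G) x, toFun (g • x) = g • toFun x
  map_rel : ∀ {i x y}, S.Rel i x y → S'.Rel (idxMap i) (toFun x) (toFun y)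

/-- Composition of embeddings of systems. -/
def Hom.comp {S S' S'' : IsoSystem G κ} (f' : Hom S' S'') (f : Hom S S') : Hom S S'' where
  toFun := f'.toFun ∘ f.toFun
  idxMap := f'.idxMap ∘ f.idxMap
  isometry := f'.isometry.comp f.isometry
  idx_isometry := f'.idx_isometry.comp f.idx_isometry
  map_smul g x := by simp [f.map_smul, f'.map_smul]
  map_rel h := f'.map_rel (f.map_rel h)

/-- The system with inverse partial isometries. -/
def op (S : IsoSystem G κ) : IsoSystem G κ :=
  { S with
    Rel := fun i x y => S.Rel i y x
    rel_coherent := fun h h' => by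
      rw [abs_sub_comm]
      exact S.rel_coherent h h'
    rel_smul := fun g _ _ _ h => S.rel_smul g h }

/-- An embedding of systems, seen as an embedding of the inverse systems. -/
def Hom.op {S S' : IsoSystem G κ} (f : Hom S S') : Hom S.op S'.op where
  toFun := f.toFun
  idxMap := f.idxMap
  isometry := f.isometry
  idx_isometry := f.idx_isometry
  map_smul := f.map_smul
  map_rel h := f.map_rel h

/-! ### Free extension of all partial isometries to the whole space. -/

section Forward

variable (S : IsoSystem G κ)

/-- The set of arrows of a system, with the distance `dist x y + 2 * dist i j`. -/
def Arrow : Type u := S.Idx × S.X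

noncomputable instance : PseudoMetricSpace S.Arrow where
  dist p q := dist p.2 q.2 + 2 * dist p.1 q.1
  dist_self p := by simp
  dist_comm p q := by simp only [dist_comm]
  dist_triangle p q r := by linarith [dist_triangle p.1 q.1 r.1, dist_triangle p.2 q.2 r.2]

lemma Arrow.dist_def (p q : S.Arrow) : dist p q = dist p.2 q.2 + 2 * dist p.1 q.1 := rfl

instance : MulAction G S.Arrow := inferInstanceAs (MulAction G (S.Idx × S.X))

instance : IsIsometricSMul G S.Arrow :=
  ⟨fun g => Isometry.of_dist_eq fun p q => by
    change dist (g • p.2) (g • q.2) + 2 * dist (g • p.1) (g • q.1) = _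
    rw [dist_smul, dist_smul, Arrow.dist_def]⟩

/-- A test function on the disjoint union of the points and of the arrows of a system. -/
structure IsTest (φ : S.X ⊕ S.Arrow → ℝ) : Prop where
  mem_Icc : ∀ p, φ p ∈ Set.Icc (0 : ℝ) 1
  sub_le : ∀ x y, φ (.inl x) - φ (.inl y) ≤ dist x y
  arrow_sub_le : ∀ a b, φ (.inr a) - φ (.inr b) ≤ dist a b
  eq_of_rel : ∀ {i x y}, S.Rel i x y → φ (.inr (i, x)) = φ (.inl y)

/-- The disjoint union of the points and of the arrows of a system, with the largest
pseudodistance bounded by `1` for which the arrow `(i, x)` is an image of `x` under a partial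
isometry extending the one of index `i`. -/
abbrev PreForward : Type u :=
  FamilySpace (fun (φ : {φ : S.X ⊕ S.Arrow → ℝ // S.IsTest φ}) p => φ.1 p) fun φ p => φ.2.mem_Icc p

/-- The canonical map to `PreForward`. -/
def toPre (p : S.X ⊕ S.Arrow) : S.PreForward := FamilySpace.of _ p

lemma isTest_smul (g : G) {φ : S.X ⊕ S.Arrow → ℝ} (h : S.IsTest φ) :
    S.IsTest fun p => φ (g • p) where
  mem_Icc _ := h.mem_Icc _
  sub_le x y := (h.sub_le _ _).trans_eq (dist_smul g x y)
  arrow_sub_le a b := (h.arrow_sub_le _ _).trans_eq (dist_smul g a b)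
  eq_of_rel hr := h.eq_of_rel (S.rel_smul g hr)

instance : IsIsometricSMul G S.PreForward :=
  FamilySpace.isIsometricSMul fun g φ => ⟨⟨_, S.isTest_smul g φ.2⟩, fun _ => rfl⟩

lemma dist_toPre_inl_le (x y : S.X) : dist (S.toPre (.inl x)) (S.toPre (.inl y)) ≤ dist x y :=
  FamilySpace.dist_le_of_sub_le dist_nonneg (fun φ => φ.2.sub_le x y)
    fun φ => (φ.2.sub_le y x).trans_eq (dist_comm _ _)

lemma dist_toPre_inr_le (i j : S.Idx) (x y : S.X) :
    dist (S.toPre (.inr (i, x))) (S.toPre (.inr (j, y))) ≤ dist x y + 2 * dist i j :=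
  FamilySpace.dist_le_of_sub_le (by positivity) (fun φ => φ.2.arrow_sub_le (i, x) (j, y))
    fun φ => (φ.2.arrow_sub_le (j, y) (i, x)).trans_eq (dist_comm _ _)

lemma dist_toPre_of_rel {i : S.Idx} {x y : S.X} (h : S.Rel i x y) :
    dist (S.toPre (.inr (i, x))) (S.toPre (.inl y)) = 0 :=
  le_antisymm (FamilySpace.dist_le le_rfl fun φ => by simp [φ.2.eq_of_rel h]) dist_nonneg

/-- Extension of a compatible pair of 1-Lipschitz functions to a test function, where the
function on the arrows is only prescribed on a set of arrows with target in `S.X` and on a fibre. -/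
lemma exists_isTest {ι : Type*} (f : S.X → ℝ) (hf : ∀ x, f x ∈ Set.Icc (0 : ℝ) 1)
    (hf' : ∀ x y, f x - f y ≤ dist x y) (a : ι → S.Arrow) (c : ι → ℝ)
    (hc : ∀ t, c t ∈ Set.Icc (0 : ℝ) 1) (hcc : ∀ t t', c t - c t' ≤ dist (a t) (a t'))
    (hcf : ∀ t i x y, S.Rel i x y → |c t - f y| ≤ dist (a t) (i, x)) :
    ∃ φ, S.IsTest φ ∧ (∀ x, φ (.inl x) = f x) ∧ ∀ t, φ (.inr (a t)) = c t := by
  let R := {r : S.Idx × S.X × S.X // S.Rel r.1 r.2.1 r.2.2}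
  obtain ⟨F, hF, hF', hFe⟩ := exists_lipschitz_extension (ι := ι ⊕ R)
    (Sum.elim a fun r => ((r.1.1, r.1.2.1) : S.Arrow)) (Sum.elim c fun r => f r.1.2.2)
    (by rintro (t | r); exacts [hc t, hf _]) (by
      rintro (t | r) (t' | r')
      · exact hcc t t'
      · exact (le_abs_self _).trans (hcf t _ _ _ r'.2)
      · refine (le_abs_self _).trans ?_
        rw [abs_sub_comm, dist_comm]
        exact hcf t' _ _ _ r.2
      -- Two arrows with known targets: coherence bounds the distance of the targets by the distance
      -- of the arrows, which is why the latter contains `2 * dist i j`.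
      · refine (hf' _ _).trans ?_
        have := (abs_le.1 (S.rel_coherent r.2 r'.2)).1
        change _ ≤ dist r.1.2.1 r'.1.2.1 + 2 * dist r.1.1 r'.1.1
        linarith)
  exact ⟨Sum.elim f F, ⟨by rintro (x | b); exacts [hf x, hF b], hf', hF',
    fun {i x y} h => hFe (.inr ⟨(i, x, y), h⟩)⟩, fun x => rfl, fun t => hFe (.inl t)⟩

/-- The function `dist · y` attains the distance. It extends to a test function, with nothing
prescribed on arrows beyond the relations. -/
lemma dist_toPre_inl (x y : S.X) : dist (S.toPre (.inl x)) (S.toPre (.inl y)) = dist x y := by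
  refine le_antisymm (S.dist_toPre_inl_le x y) ?_
  obtain ⟨φ, h, h1, -⟩ := S.exists_isTest (ι := PEmpty.{1}) (fun z => dist z y)
    (fun z => ⟨dist_nonneg, S.dist_le_one _ _⟩)
    (fun z w => by linarith [dist_triangle z w y]) PEmpty.elim PEmpty.elim (fun t => t.elim)
    (fun t => t.elim) (fun t => t.elim)
  refine le_trans ?_ (FamilySpace.abs_sub_le_dist (⟨φ, h⟩ : {φ // S.IsTest φ}) _ _)
  simp only [h1, dist_self, sub_zero]
  exact le_abs_self _

/-- The test function has to be `dist · y` on the fibre of `i`. A relation `(j, z, w)` then forces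
its value at `w` to be within `2 * dist i j` of `dist z y`; coherence is what makes these tolerances
compatible. -/
lemma dist_toPre_fibre (i : S.Idx) (x y : S.X) :
    dist (S.toPre (.inr (i, x))) (S.toPre (.inr (i, y))) = dist x y := by
  refine le_antisymm ((S.dist_toPre_inr_le i i x y).trans_eq (by simp)) ?_
  obtain ⟨f, hf, hf', hft⟩ := exists_lipschitz_of_tolerance
    (ι := {r : S.Idx × S.X × S.X // S.Rel r.1 r.2.1 r.2.2}) (fun r => r.1.2.2)
    (fun r => dist r.1.2.1 y) (fun r => 2 * dist i r.1.1)
    (fun r => ⟨dist_nonneg, S.dist_le_one _ _⟩) (fun r => by positivity) (by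
      intro r r'
      have h1 := (abs_le.1 (S.rel_coherent r.2 r'.2)).2
      have h2 := dist_triangle r.1.2.1 r'.1.2.1 y
      have h3 := dist_triangle r.1.1 i r'.1.1
      rw [dist_comm r.1.1 i] at h3
      linarith)
  obtain ⟨φ, h, -, h2⟩ := S.exists_isTest f hf hf' (fun x => ((i, x) : S.Arrow))
    (fun x => dist x y) (fun z => ⟨dist_nonneg, S.dist_le_one _ _⟩)
    (fun z w => by
      change _ ≤ dist z w + 2 * dist i i
      rw [dist_self]
      linarith [dist_triangle z w y])
    (fun t j z w hr => by
      change _ ≤ dist t z + 2 * dist i j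
      refine (abs_sub_le _ (dist z y) _).trans (add_le_add (abs_dist_sub_le _ _ _) ?_)
      rw [abs_sub_comm]
      exact hft ⟨(j, z, w), hr⟩)
  refine le_trans ?_ (FamilySpace.abs_sub_le_dist (⟨φ, h⟩ : {φ // S.IsTest φ}) _ _)
  simp only [h2, dist_self, sub_zero]
  exact le_abs_self _

/-- The points of the system `S.forward`. -/
abbrev ForwardSpace : Type u := SeparationQuotient S.PreForward

/-- The class of a point or of an arrow. -/
noncomputable def toForward (p : S.X ⊕ S.Arrow) : S.ForwardSpace := SeparationQuotient.mk (S.toPre p)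

lemma dist_toForward (p q : S.X ⊕ S.Arrow) :
    dist (S.toForward p) (S.toForward q) = dist (S.toPre p) (S.toPre q) :=
  SeparationQuotient.dist_mk _ _

lemma exists_toForward_eq (p : S.ForwardSpace) : ∃ q, S.toForward q = p :=
  SeparationQuotient.surjective_mk p

lemma continuous_toForward_inl : Continuous fun x : S.X => S.toForward (.inl x) :=
  (Isometry.of_dist_eq fun x y => by rw [dist_toForward, dist_toPre_inl]).continuous

lemma continuous_toForward_inr : Continuous fun p : S.Idx × S.X => S.toForward (.inr p) := by
  refine continuous_iff_continuousAt.2 fun p => tendsto_iff_dist_tendsto_zero.2 ?_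
  refine squeeze_zero (fun _ => dist_nonneg)
    (fun q => (S.dist_toForward _ _).trans_le (S.dist_toPre_inr_le _ _ _ _)) ?_
  have : Continuous fun q : S.Idx × S.X => dist q.2 p.2 + 2 * dist q.1 p.1 := by fun_prop
  simpa using! this.tendsto p

lemma hasDense_forwardSpace (hκ : ℵ₀ ≤ κ) : HasDense κ S.ForwardSpace := by
  refine (S.hasDense.sum hκ (S.hasDense_idx.prod hκ S.hasDense)).map
    (f := Sum.elim (fun x => S.toForward (.inl x)) fun p => S.toForward (.inr p))
    (continuous_sumElim.2 ⟨S.continuous_toForward_inl, S.continuous_toForward_inr⟩) ?_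
  refine Function.Surjective.denseRange fun p => ?_
  obtain ⟨x | a, rfl⟩ := S.exists_toForward_eq p
  exacts [⟨.inl x, rfl⟩, ⟨.inr a, rfl⟩]

/-- The system obtained by adding the images of all points under all partial isometries. -/
noncomputable def forward (hκ : ℵ₀ ≤ κ) : IsoSystem G κ where
  X := S.ForwardSpace
  Idx := S.Idx
  dist_le_one x y := by
    obtain ⟨x, rfl⟩ := S.exists_toForward_eq x
    obtain ⟨y, rfl⟩ := S.exists_toForward_eq y
    rw [dist_toForward]
    exact FamilySpace.dist_le_one _ _
  idx_dist_le_one := S.idx_dist_le_one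
  tendsto_smul x := by
    obtain ⟨x | ⟨i, x⟩, rfl⟩ := S.exists_toForward_eq x
    · exact (S.continuous_toForward_inl.tendsto x).comp (S.tendsto_smul x)
    · exact (S.continuous_toForward_inr.tendsto (i, x)).comp
        ((S.tendsto_smul_idx i).prodMk_nhds (S.tendsto_smul x))
  tendsto_smul_idx := S.tendsto_smul_idx
  hasDense := S.hasDense_forwardSpace hκ
  hasDense_idx := S.hasDense_idx
  Rel i p q := ∃ x, S.toForward (.inl x) = p ∧ S.toForward (.inr (i, x)) = q
  rel_coherent := by
    rintro i j _ _ _ _ ⟨x, rfl, rfl⟩ ⟨x', rfl, rfl⟩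
    rw [dist_toForward, dist_toForward, dist_toPre_inl, abs_sub_le_iff]
    -- Replacing `(j, x')` by `(i, x')` costs at most `2 * dist i j`, and the fibre of `i` is a copy
    -- of the space.
    have h1 := S.dist_toPre_inr_le i j x' x'
    have h2 := S.dist_toPre_fibre i x x'
    have h3 := S.dist_toPre_inr_le i j x x'
    have h4 := dist_triangle_right (S.toPre (.inr (i, x))) (S.toPre (.inr (i, x')))
      (S.toPre (.inr (j, x')))
    rw [dist_self] at h1
    constructor <;> linarith
  rel_smul := by
    rintro g i _ _ ⟨x, rfl, rfl⟩
    exact ⟨g • x, rfl, rfl⟩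

/-- The embedding of a system in the one obtained by adding images. -/
noncomputable def toForwardHom (hκ : ℵ₀ ≤ κ) : Hom S (S.forward hκ) where
  toFun x := S.toForward (.inl x)
  idxMap := id
  isometry := Isometry.of_dist_eq fun x y => by
    rw [← S.dist_toPre_inl, ← S.dist_toForward]
    rfl
  idx_isometry := isometry_id
  map_smul g x := rfl
  map_rel {i x y} h := ⟨x, rfl, eq_of_dist_eq_zero ((S.dist_toForward _ _).trans
    (S.dist_toPre_of_rel h))⟩

lemma forward_rel_exists (hκ : ℵ₀ ≤ κ) (i : S.Idx) (x : S.X) :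
    ∃ y, (S.forward hκ).Rel i ((S.toForwardHom hκ).toFun x) y := ⟨_, x, rfl, rfl⟩

end Forward

end IsoSystem

/-! ### Disjoint sums at distance `1`. -/

/-- The disjoint union of two pseudometric spaces of diameter at most `1`, placed at distance `1`
from each other. -/
def BoundedSum (A B : Type*) [PseudoMetricSpace A] [PseudoMetricSpace B]
    (_ : ∀ a b : A, dist a b ≤ 1) (_ : ∀ a b : B, dist a b ≤ 1) : Type _ := A ⊕ B

namespace BoundedSum

variable {A B : Type*} [PseudoMetricSpace A] [PseudoMetricSpace B]
  {hA : ∀ a b : A, dist a b ≤ 1} {hB : ∀ a b : B, dist a b ≤ 1}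

noncomputable instance : PseudoMetricSpace (BoundedSum A B hA hB) where
  dist
    | .inl a, .inl b => dist a b
    | .inr a, .inr b => dist a b
    | _, _ => 1
  dist_self := by rintro (a | a) <;> exact dist_self _
  dist_comm := by rintro (a | a) (b | b) <;> first | rfl | exact dist_comm _ _
  dist_triangle := by
    rintro (a | a) (b | b) (c | c)
    · exact dist_triangle a b c
    · exact le_add_of_nonneg_left dist_nonneg
    · exact (hA a c).trans (by norm_num)
    · exact le_add_of_nonneg_right dist_nonneg
    · exact le_add_of_nonneg_right dist_nonneg
    · exact (hB a c).trans (by norm_num)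
    · exact le_add_of_nonneg_left dist_nonneg
    · exact dist_triangle a b c

/-- The inclusion of the first summand. -/
def inl (a : A) : BoundedSum A B hA hB := Sum.inl a

/-- The inclusion of the second summand. -/
def inr (b : B) : BoundedSum A B hA hB := Sum.inr b

lemma isometry_inl : Isometry (inl : A → BoundedSum A B hA hB) :=
  Isometry.of_dist_eq fun _ _ => rfl

lemma isometry_inr : Isometry (inr : B → BoundedSum A B hA hB) :=
  Isometry.of_dist_eq fun _ _ => rfl

lemma dist_le_one : ∀ p q : BoundedSum A B hA hB, dist p q ≤ 1 := by
  rintro (a | a) (b | b)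
  exacts [hA a b, le_rfl, le_rfl, hB a b]

variable {G : Type*} [Group G] [MulAction G A] [MulAction G B]

instance : MulAction G (BoundedSum A B hA hB) := inferInstanceAs (MulAction G (A ⊕ B))

instance [IsIsometricSMul G A] [IsIsometricSMul G B] :
    IsIsometricSMul G (BoundedSum A B hA hB) :=
  ⟨fun g => Isometry.of_dist_eq <| by
    rintro (a | a) (b | b)
    exacts [dist_smul g a b, rfl, rfl, dist_smul g a b]⟩

lemma tendsto_smul [TopologicalSpace G]
    (h : ∀ a : A, Filter.Tendsto (fun g : G => g • a) (𝓝 1) (𝓝 a))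
    (h' : ∀ b : B, Filter.Tendsto (fun g : G => g • b) (𝓝 1) (𝓝 b)) (p : BoundedSum A B hA hB) :
    Filter.Tendsto (fun g : G => g • p) (𝓝 1) (𝓝 p) := by
  rcases p with a | b
  · exact (isometry_inl.continuous.tendsto a).comp (h a)
  · exact (isometry_inr.continuous.tendsto b).comp (h' b)

end BoundedSum

lemma HasDense.boundedSum {κ : Cardinal.{u}} (hκ : ℵ₀ ≤ κ) {A B : Type u} [PseudoMetricSpace A]
    [PseudoMetricSpace B] {hA : ∀ a b : A, dist a b ≤ 1} {hB : ∀ a b : B, dist a b ≤ 1}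
    (h : HasDense κ A) (h' : HasDense κ B) : HasDense κ (BoundedSum A B hA hB) := by
  refine (h.sum hκ h').map (f := Sum.elim BoundedSum.inl BoundedSum.inr)
    (continuous_sumElim.2 ⟨BoundedSum.isometry_inl.continuous,
      BoundedSum.isometry_inr.continuous⟩) (Function.Surjective.denseRange ?_)
  rintro (a | b)
  exacts [⟨.inl a, rfl⟩, ⟨.inr b, rfl⟩]

namespace IsoSystem

variable {G : Type u} [Group G] [TopologicalSpace G] {κ : Cardinal.{u}}

/-! ### Adding the isometries between tuples of a given length. -/

section Tuples

variable (S : IsoSystem G κ) (hκ : ℵ₀ ≤ κ) (n : ℕ)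

lemma tuple_dist_le_one (p q : (Fin n → S.X) × (Fin n → S.X)) : dist p q ≤ 1 :=
  max_le ((dist_pi_le_iff zero_le_one).2 fun _ => S.dist_le_one _ _)
    ((dist_pi_le_iff zero_le_one).2 fun _ => S.dist_le_one _ _)

/-- The partial isometry attached to a pair of isometric tuples. -/
def TupleRel (p : (Fin n → S.X) × (Fin n → S.X)) (x y : S.X) : Prop :=
  (∀ a b, dist (p.1 a) (p.1 b) = dist (p.2 a) (p.2 b)) ∧ ∃ a, p.1 a = x ∧ p.2 a = y

-- The two points of `q` are compared with the entries of `p` in the same position, at a cost of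
-- `dist p q` for the source and again for the target: hence the constant `2`.
variable {S n} in
lemma TupleRel.coherent {p q : (Fin n → S.X) × (Fin n → S.X)} {x y x' y' : S.X}
    (h : S.TupleRel n p x y) (h' : S.TupleRel n q x' y') :
    |dist x x' - dist y y'| ≤ 2 * dist p q := by
  obtain ⟨hp, a, rfl, rfl⟩ := h
  obtain ⟨-, b, rfl, rfl⟩ := h'
  have h1 : dist (p.1 b) (q.1 b) ≤ dist p q := (dist_le_pi_dist p.1 q.1 b).trans (le_max_left _ _)
  have h2 : dist (p.2 b) (q.2 b) ≤ dist p q := (dist_le_pi_dist p.2 q.2 b).trans (le_max_right _ _)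
  have h3 := hp a b
  rw [abs_sub_le_iff]
  constructor
  · linarith [dist_triangle (p.1 a) (p.1 b) (q.1 b), dist_triangle_right (p.2 a) (p.2 b) (q.2 b)]
  · linarith [dist_triangle (p.2 a) (p.2 b) (q.2 b), dist_triangle_right (p.1 a) (p.1 b) (q.1 b)]

/-- The system obtained by adding all isometries between tuples of length `n`. -/
noncomputable def addTuples : IsoSystem G κ where
  X := S.X
  Idx := BoundedSum S.Idx ((Fin n → S.X) × (Fin n → S.X)) S.idx_dist_le_one (S.tuple_dist_le_one n)
  dist_le_one := S.dist_le_one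
  idx_dist_le_one := BoundedSum.dist_le_one
  tendsto_smul := S.tendsto_smul
  tendsto_smul_idx := BoundedSum.tendsto_smul S.tendsto_smul_idx fun p =>
    (tendsto_pi_nhds.2 fun _ => S.tendsto_smul _).prodMk_nhds
      (tendsto_pi_nhds.2 fun _ => S.tendsto_smul _)
  hasDense := S.hasDense
  -- All pairs of tuples are indices, with empty relation when they are not isometric, so the
  -- density bound is that of a product.
  hasDense_idx := S.hasDense_idx.boundedSum hκ
    ((S.hasDense.pi hκ n).prod hκ (S.hasDense.pi hκ n))
  Rel i x y := Sum.elim (fun i => S.Rel i x y) (fun p => S.TupleRel n p x y) i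
  rel_coherent := by
    -- Old and new indices are at distance `1`, so coherence between them is automatic in diameter
    -- at most `1`.
    have h1 : ∀ x x' y y' : S.X, |dist x x' - dist y y'| ≤ 2 * 1 := fun x x' y y' =>
      (abs_sub_le_of_nonneg_of_le dist_nonneg (S.dist_le_one x x') dist_nonneg
        (S.dist_le_one y y')).trans (by norm_num)
    rintro (i | p) (j | q) x y x' y' h h'
    exacts [S.rel_coherent h h', h1 x x' y y', h1 x x' y y', h.coherent h']
  rel_smul := by
    rintro g (i | p) x y h
    · exact S.rel_smul g h
    · obtain ⟨h1, a, rfl, rfl⟩ := h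
      refine ⟨fun a b => ?_, a, rfl, rfl⟩
      change dist (g • p.1 a) (g • p.1 b) = dist (g • p.2 a) (g • p.2 b)
      rw [dist_smul, dist_smul, h1]

/-- The embedding of a system in the one with all isometries between tuples of length `n`. -/
noncomputable def toAddTuples : Hom S (S.addTuples hκ n) where
  toFun := id
  idxMap := BoundedSum.inl
  isometry := isometry_id
  idx_isometry := BoundedSum.isometry_inl
  map_smul _ _ := rfl
  map_rel h := h

/-- One step of the construction: add all isometries between tuples of length `n`, then extend
the domains and the ranges of all partial isometries. -/
noncomputable def step : IsoSystem G κ := (((S.addTuples hκ n).forward hκ).op.forward hκ).op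

/-- The embedding of the system with all isometries between tuples of length `n` in the next
system. -/
noncomputable def extHom : Hom (S.addTuples hκ n) (S.step hκ n) :=
  (((S.addTuples hκ n).forward hκ).op.toForwardHom hκ).op.comp ((S.addTuples hκ n).toForwardHom hκ)

/-- The embedding of a system in the next one. -/
noncomputable def toStep : Hom S (S.step hκ n) := (S.extHom hκ n).comp (S.toAddTuples hκ n)

lemma step_rel_exists (i : S.Idx) (x : S.X) :
    ∃ y, (S.step hκ n).Rel ((S.toStep hκ n).idxMap i) ((S.toStep hκ n).toFun x) y := by
  obtain ⟨y, hy⟩ := (S.addTuples hκ n).forward_rel_exists hκ ((S.toAddTuples hκ n).idxMap i) x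
  exact ⟨_, (((S.addTuples hκ n).forward hκ).op.toForwardHom hκ).op.map_rel hy⟩

lemma step_exists_rel (i : S.Idx) (y : S.X) :
    ∃ x, (S.step hκ n).Rel ((S.toStep hκ n).idxMap i) x ((S.toStep hκ n).toFun y) :=
  ((S.addTuples hκ n).forward hκ).op.forward_rel_exists hκ ((S.toAddTuples hκ n).idxMap i) _

/-- The index of the isometry between two tuples. -/
noncomputable def tupleIdx (u v : Fin n → S.X) : (S.step hκ n).Idx :=
  (S.extHom hκ n).idxMap (BoundedSum.inr (u, v) :
    BoundedSum S.Idx _ S.idx_dist_le_one (S.tuple_dist_le_one n))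

lemma dist_tupleIdx (u v u' v' : Fin n → S.X) :
    dist (S.tupleIdx hκ n u v) (S.tupleIdx hκ n u' v') = max (dist u u') (dist v v') :=
  (S.extHom hκ n).idx_isometry.dist_eq _ _

lemma tupleIdx_rel {u v : Fin n → S.X} (h : ∀ a b, dist (u a) (u b) = dist (v a) (v b))
    (a : Fin n) : (S.step hκ n).Rel (S.tupleIdx hκ n u v) ((S.toStep hκ n).toFun (u a))
      ((S.toStep hκ n).toFun (v a)) :=
  (S.extHom hκ n).map_rel (i := (BoundedSum.inr (u, v) :
    BoundedSum S.Idx _ S.idx_dist_le_one (S.tuple_dist_le_one n))) ⟨h, a, rfl, rfl⟩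

end Tuples

/-! ### The union of the iterated construction and its action. -/

section Limit

variable (S : IsoSystem G κ) (hκ : ℵ₀ ≤ κ)

/-- The sequence of systems obtained by iterating the construction. -/
noncomputable def chain : ℕ → IsoSystem G κ
  | 0 => S
  -- Each stage treats a single length; shorter tuples are later padded by repeating entries.
  | n + 1 => (chain n).step hκ n

/-- The transition maps of the sequence of systems. -/
noncomputable def chainHom (n : ℕ) : Hom (S.chain hκ n) (S.chain hκ (n + 1)) :=
  (S.chain hκ n).toStep hκ n

/-- The union of the sequence of systems. -/
def Limit : Type u :=
  Metric.InductiveLimit (X := fun n => (S.chain hκ n).X) (f := fun n => (S.chainHom hκ n).toFun)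
    fun n => (S.chainHom hκ n).isometry

noncomputable instance : MetricSpace (S.Limit hκ) :=
  inferInstanceAs (MetricSpace (Metric.InductiveLimit (X := fun n => (S.chain hκ n).X)
    (f := fun n => (S.chainHom hκ n).toFun) fun n => (S.chainHom hκ n).isometry))

/-- The inclusion of the `n`-th system in the union. -/
noncomputable def toLimit (n : ℕ) (x : (S.chain hκ n).X) : S.Limit hκ :=
  Metric.toInductiveLimit (X := fun n => (S.chain hκ n).X)
    (fun n => (S.chainHom hκ n).isometry) n x

lemma isometry_toLimit (n : ℕ) : Isometry (S.toLimit hκ n) :=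
  Metric.toInductiveLimit_isometry (X := fun n => (S.chain hκ n).X)
    (fun n => (S.chainHom hκ n).isometry) n

lemma toLimit_chainHom (n : ℕ) (x : (S.chain hκ n).X) :
    S.toLimit hκ (n + 1) ((S.chainHom hκ n).toFun x) = S.toLimit hκ n x :=
  congrFun (Metric.toInductiveLimit_commute (X := fun n => (S.chain hκ n).X)
    (fun n => (S.chainHom hκ n).isometry) n) x

lemma exists_toLimit (p : S.Limit hκ) : ∃ n x, S.toLimit hκ n x = p := by
  obtain ⟨⟨n, x⟩, rfl⟩ := Quotient.exists_rep p
  exact ⟨n, x, rfl⟩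

lemma range_toLimit_mono : Monotone fun n => Set.range (S.toLimit hκ n) := by
  refine monotone_nat_of_le_succ fun n => ?_
  rintro _ ⟨x, rfl⟩
  exact ⟨_, S.toLimit_chainHom hκ n x⟩

lemma exists_toLimit_of_finite {ι : Type*} [Finite ι] (u : ι → S.Limit hκ) :
    ∃ n, ∀ m ≥ n, ∃ x : ι → (S.chain hκ m).X, ∀ a, S.toLimit hκ m (x a) = u a := by
  choose n x hx using fun a => S.exists_toLimit hκ (u a)
  obtain ⟨N, hN⟩ := (Set.finite_range n).bddAbove
  refine ⟨N, fun m hm => ?_⟩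
  choose y hy using fun a =>
    S.range_toLimit_mono hκ ((hN ⟨a, rfl⟩).trans hm) ⟨x a, hx a⟩
  exact ⟨y, hy⟩

end Limit

end IsoSystem

namespace IsoSystem

variable {G : Type u} [Group G] [TopologicalSpace G] {κ : Cardinal.{u}}
  (S : IsoSystem G κ) (hκ : ℵ₀ ≤ κ)

/-- A point is carried to a later stage together with its orbit, which makes the action on the union
independent of representatives. -/
lemma exists_lift {n m : ℕ} (h : n ≤ m) (x : (S.chain hκ n).X) :
    ∃ y : (S.chain hκ m).X, ∀ g : G, S.toLimit hκ m (g • y) = S.toLimit hκ n (g • x) := by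
  induction m, h using Nat.le_induction with
  | base => exact ⟨x, fun _ => rfl⟩
  | succ m _ ih =>
    obtain ⟨y, hy⟩ := ih
    refine ⟨(S.chainHom hκ m).toFun y, fun g => ?_⟩
    rw [← (S.chainHom hκ m).map_smul, toLimit_chainHom, hy]

lemma toLimit_smul_congr {n m : ℕ} {x : (S.chain hκ n).X} {y : (S.chain hκ m).X}
    (h : S.toLimit hκ n x = S.toLimit hκ m y) (g : G) :
    S.toLimit hκ n (g • x) = S.toLimit hκ m (g • y) := by
  obtain ⟨x', hx⟩ := S.exists_lift hκ (le_max_left n m) x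
  obtain ⟨y', hy⟩ := S.exists_lift hκ (le_max_right n m) y
  have h1 := hx 1
  have h2 := hy 1
  rw [one_smul, one_smul] at h1 h2
  have : x' = y' := (S.isometry_toLimit hκ _).injective (by rw [h1, h2, h])
  rw [← hx, ← hy, this]

noncomputable instance : SMul G (S.Limit hκ) where
  smul g p := S.toLimit hκ (S.exists_toLimit hκ p).choose
    (g • (S.exists_toLimit hκ p).choose_spec.choose)

lemma smul_toLimit (g : G) (n : ℕ) (x : (S.chain hκ n).X) :
    g • S.toLimit hκ n x = S.toLimit hκ n (g • x) :=
  S.toLimit_smul_congr hκ (S.exists_toLimit hκ (S.toLimit hκ n x)).choose_spec.choose_spec g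

noncomputable instance : MulAction G (S.Limit hκ) where
  one_smul p := by
    obtain ⟨n, x, rfl⟩ := S.exists_toLimit hκ p
    rw [smul_toLimit, one_smul]
  mul_smul g h p := by
    obtain ⟨n, x, rfl⟩ := S.exists_toLimit hκ p
    rw [smul_toLimit, smul_toLimit, smul_toLimit, mul_smul]

lemma exists_toLimit_pair (p q : S.Limit hκ) :
    ∃ n x y, S.toLimit hκ n x = p ∧ S.toLimit hκ n y = q := by
  obtain ⟨n, hn⟩ := S.exists_toLimit_of_finite hκ ![p, q]
  obtain ⟨x, hx⟩ := hn n le_rfl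
  exact ⟨n, x 0, x 1, hx 0, hx 1⟩

instance : IsIsometricSMul G (S.Limit hκ) := by
  refine ⟨fun g => Isometry.of_dist_eq fun p q => ?_⟩
  obtain ⟨n, x, y, rfl, rfl⟩ := S.exists_toLimit_pair hκ p q
  rw [smul_toLimit, smul_toLimit, (S.isometry_toLimit hκ n).dist_eq,
    (S.isometry_toLimit hκ n).dist_eq, dist_smul]

lemma limit_dist_le_one (p q : S.Limit hκ) : dist p q ≤ 1 := by
  obtain ⟨n, x, y, rfl, rfl⟩ := S.exists_toLimit_pair hκ p q
  rw [(S.isometry_toLimit hκ n).dist_eq]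
  exact (S.chain hκ n).dist_le_one x y

lemma limit_tendsto_smul (p : S.Limit hκ) :
    Filter.Tendsto (fun g : G => g • p) (𝓝 1) (𝓝 p) := by
  obtain ⟨n, x, rfl⟩ := S.exists_toLimit hκ p
  simp only [smul_toLimit]
  exact ((S.isometry_toLimit hκ n).continuous.tendsto x).comp ((S.chain hκ n).tendsto_smul x)

lemma hasDense_limit : HasDense κ (S.Limit hκ) := by
  choose ι s hι hs using fun n => (S.chain hκ n).hasDense
  refine ⟨Σ n : ULift.{u} ℕ, ι n.down, fun i => S.toLimit hκ i.1.down (s _ i.2), ?_, ?_⟩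
  · rw [mk_sigma]
    refine (sum_le_mk_mul_iSup _).trans ?_
    refine (mul_le_mul' (by simpa using hκ) (ciSup_le' fun n : ULift.{u} ℕ => hι n.down)).trans
      (mul_eq_self hκ).le
  · intro p
    obtain ⟨n, x, rfl⟩ := S.exists_toLimit hκ p
    refine map_mem_closure (S.isometry_toLimit hκ n).continuous (hs n x) ?_
    rintro _ ⟨i, rfl⟩
    exact ⟨⟨⟨n⟩, i⟩, rfl⟩

/-- The image of an index in the later systems. -/
noncomputable def idxLift {n : ℕ} (i : (S.chain hκ n).Idx) : ∀ m, (S.chain hκ (n + m)).Idx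
  | 0 => i
  | m + 1 => (S.chainHom hκ (n + m)).idxMap (idxLift i m)

lemma dist_idxLift {n : ℕ} (i j : (S.chain hκ n).Idx) (m : ℕ) :
    dist (S.idxLift hκ i m) (S.idxLift hκ j m) = dist i j := by
  induction m with
  | zero => rfl
  | succ m ih => exact ((S.chainHom hκ (n + m)).idx_isometry.dist_eq _ _).trans ih

/-- The isometry of index `i` of the union, as a relation that holds at stage `m`. -/
def LimitRelAt {n : ℕ} (i : (S.chain hκ n).Idx) (m : ℕ) (p q : S.Limit hκ) : Prop :=
  ∃ x y, S.toLimit hκ (n + m) x = p ∧ S.toLimit hκ (n + m) y = q ∧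
    (S.chain hκ (n + m)).Rel (S.idxLift hκ i m) x y

variable {S hκ} in
lemma LimitRelAt.mono {n : ℕ} {i : (S.chain hκ n).Idx} {m m' : ℕ} {p q : S.Limit hκ}
    (h : S.LimitRelAt hκ i m p q) (hm : m ≤ m') : S.LimitRelAt hκ i m' p q := by
  induction m', hm using Nat.le_induction with
  | base => exact h
  | succ k _ ih =>
    obtain ⟨x, y, hx, hy, hxy⟩ := ih
    exact ⟨_, _, (S.toLimit_chainHom hκ (n + k) x).trans hx,
      (S.toLimit_chainHom hκ (n + k) y).trans hy, (S.chainHom hκ (n + k)).map_rel hxy⟩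

-- Both relations are moved to a common stage, where the indices have kept their distance. The case
-- `i = j` gives isometries, the case `p = p'` their Lipschitz dependence on the index.
variable {S hκ} in
lemma LimitRelAt.coherent {n : ℕ} {i j : (S.chain hκ n).Idx} {m m' : ℕ} {p q p' q' : S.Limit hκ}
    (h : S.LimitRelAt hκ i m p q) (h' : S.LimitRelAt hκ j m' p' q') :
    |dist p p' - dist q q'| ≤ 2 * dist i j := by
  obtain ⟨x, y, rfl, rfl, hxy⟩ := h.mono (le_max_left m m')
  obtain ⟨x', y', rfl, rfl, hxy'⟩ := h'.mono (le_max_right m m')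
  rw [(S.isometry_toLimit hκ _).dist_eq, (S.isometry_toLimit hκ _).dist_eq,
    ← S.dist_idxLift hκ i j (max m m')]
  exact (S.chain hκ _).rel_coherent hxy hxy'

variable {S hκ} in
lemma LimitRelAt.unique {n : ℕ} {i : (S.chain hκ n).Idx} {m m' : ℕ} {p q q' : S.Limit hκ}
    (h : S.LimitRelAt hκ i m p q) (h' : S.LimitRelAt hκ i m' p q') : q = q' := by
  have := h.coherent h'
  rw [dist_self, dist_self, mul_zero, abs_nonpos_iff, sub_eq_zero] at this
  exact dist_eq_zero.1 this.symm

/-- The index of the isometry between two tuples of points of the `n`-th system. -/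
noncomputable def chainIdx (n : ℕ) (u v : Fin n → (S.chain hκ n).X) : (S.chain hκ (n + 1)).Idx :=
  (S.chain hκ n).tupleIdx hκ n u v

lemma dist_chainIdx (n : ℕ) (u v u' v' : Fin n → (S.chain hκ n).X) :
    dist (S.chainIdx hκ n u v) (S.chainIdx hκ n u' v') = max (dist u u') (dist v v') :=
  (S.chain hκ n).dist_tupleIdx hκ n u v u' v'

lemma exists_limitRelAt_left {n : ℕ} (i : (S.chain hκ n).Idx) (p : S.Limit hκ) :
    ∃ q m, S.LimitRelAt hκ i m p q := by
  obtain ⟨N, hN⟩ := S.exists_toLimit_of_finite hκ ![p]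
  obtain ⟨x, hx⟩ := hN (n + N) (by omega)
  obtain ⟨y, hy⟩ := (S.chain hκ (n + N)).step_rel_exists hκ (n + N) (S.idxLift hκ i N) (x 0)
  exact ⟨_, N + 1, _, y, (S.toLimit_chainHom hκ (n + N) _).trans (hx 0), rfl, hy⟩

lemma exists_limitRelAt_right {n : ℕ} (i : (S.chain hκ n).Idx) (q : S.Limit hκ) :
    ∃ p m, S.LimitRelAt hκ i m p q := by
  obtain ⟨N, hN⟩ := S.exists_toLimit_of_finite hκ ![q]
  obtain ⟨y, hy⟩ := hN (n + N) (by omega)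
  obtain ⟨x, hx⟩ := (S.chain hκ (n + N)).step_exists_rel hκ (n + N) (S.idxLift hκ i N) (y 0)
  exact ⟨_, N + 1, x, _, rfl, (S.toLimit_chainHom hκ (n + N) _).trans (hy 0), hx⟩

/-- The relations of all stages together form the graph of a total, single-valued, surjective
isometry. -/
lemma exists_limit_isometryEquiv {n : ℕ} (i : (S.chain hκ n).Idx) :
    ∃ T : S.Limit hκ ≃ᵢ S.Limit hκ, ∀ p, ∃ m, S.LimitRelAt hκ i m p (T p) := by
  choose T t hT using S.exists_limitRelAt_left hκ i
  have hiso : Isometry T := Isometry.of_dist_eq fun p q => by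
    have := (hT p).coherent (hT q)
    rw [dist_self, mul_zero, abs_nonpos_iff, sub_eq_zero] at this
    exact this.symm
  have hsurj : Function.Surjective T := fun q => by
    obtain ⟨p, m, hp⟩ := S.exists_limitRelAt_right hκ i q
    exact ⟨p, (hT p).unique hp⟩
  exact ⟨IsometryEquiv.mk (Equiv.ofBijective T ⟨hiso.injective, hsurj⟩) hiso,
    fun p => ⟨t p, hT p⟩⟩

end IsoSystem

/-! ### Homogeneity of the union, with control of displacements. -/

/-- Isometries between finite families of points of `L` extend to isometries of `L` that move
points by at most twice as much as they move these families. -/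
def IsUniformlyHomogeneous (L : Type*) [MetricSpace L] : Prop :=
  ∀ (n : ℕ) (u v : Fin n → L), (∀ a b, dist (u a) (u b) = dist (v a) (v b)) →
    ∃ g : L ≃ᵢ L, (∀ a, g (u a) = v a) ∧
      ∀ ε : ℝ, 0 ≤ ε → (∀ a, dist (u a) (v a) ≤ ε) → ∀ x, dist (g x) x ≤ 2 * ε

namespace IsoSystem

variable {G : Type u} [Group G] [TopologicalSpace G] {κ : Cardinal.{u}}
  (S : IsoSystem G κ) (hκ : ℵ₀ ≤ κ)

/-- The isometry of index `(u, v)` may move points far away even if `v` is close to `u`. Composing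
it with the inverse of the one of index `(u, u)` corrects this, since the two indices are at
distance `dist u v`. -/
theorem isUniformlyHomogeneous_limit : IsUniformlyHomogeneous (S.Limit hκ) := by
  intro n u v huv
  rcases Nat.eq_zero_or_pos n with rfl | hn
  · exact ⟨IsometryEquiv.refl _, fun a => a.elim0, fun ε hε _ x => (dist_self x).trans_le (by positivity)⟩
  have : Nonempty (Fin n) := ⟨⟨0, hn⟩⟩
  obtain ⟨N, hN⟩ := S.exists_toLimit_of_finite hκ (Sum.elim u v)
  obtain ⟨M, hnM, w, hw⟩ : ∃ M, n ≤ M ∧ ∃ w : Fin n ⊕ Fin n → (S.chain hκ M).X,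
      ∀ a, S.toLimit hκ M (w a) = Sum.elim u v a :=
    ⟨max N n, le_max_right _ _, hN _ (le_max_left _ _)⟩
  -- The tuples are padded along a surjection to the length `M` treated at stage `M`.
  let r : Fin M → Fin n := Function.invFun (Fin.castLE hnM)
  have hr : Function.Surjective r := Function.invFun_surjective (Fin.castLE_injective hnM)
  let u' : Fin M → (S.chain hκ M).X := fun a => w (.inl (r a))
  let v' : Fin M → (S.chain hκ M).X := fun a => w (.inr (r a))
  have hu' : ∀ a, S.toLimit hκ M (u' a) = u (r a) := fun a => hw _
  have hv' : ∀ a, S.toLimit hκ M (v' a) = v (r a) := fun a => hw _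
  have huv' : ∀ a b, dist (u' a) (u' b) = dist (v' a) (v' b) := fun a b => by
    rw [← (S.isometry_toLimit hκ M).dist_eq, ← (S.isometry_toLimit hκ M).dist_eq, hu', hu', hv',
      hv', huv]
  have key : ∀ (z : Fin M → (S.chain hκ M).X), (∀ a b, dist (u' a) (u' b) = dist (z a) (z b)) →
      ∀ a, S.LimitRelAt hκ (S.chainIdx hκ M u' z) 0
        (S.toLimit hκ M (u' a)) (S.toLimit hκ M (z a)) := fun z hz a =>
    ⟨_, _, S.toLimit_chainHom hκ M _, S.toLimit_chainHom hκ M _,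
      (S.chain hκ M).tupleIdx_rel hκ M hz a⟩
  obtain ⟨T, hT⟩ := S.exists_limit_isometryEquiv hκ (S.chainIdx hκ M u' v')
  obtain ⟨T₀, hT₀⟩ := S.exists_limit_isometryEquiv hκ (S.chainIdx hκ M u' u')
  have hT' : ∀ a, T (u a) = v a := fun a => by
    obtain ⟨a, rfl⟩ := hr a
    obtain ⟨m, hm⟩ := hT (u (r a))
    have h := key v' huv' a
    rw [hu', hv'] at h
    exact hm.unique h
  have hT₀' : ∀ a, T₀ (u a) = u a := fun a => by
    obtain ⟨a, rfl⟩ := hr a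
    obtain ⟨m, hm⟩ := hT₀ (u (r a))
    have h := key u' (fun _ _ => rfl) a
    rw [hu'] at h
    exact hm.unique h
  refine ⟨T₀.symm.trans T, fun a => ?_, fun ε hε h x => ?_⟩
  · rw [IsometryEquiv.trans_apply, (IsometryEquiv.symm_apply_eq T₀).2 (hT₀' a).symm, hT']
  · obtain ⟨y, rfl⟩ := T₀.surjective x
    rw [IsometryEquiv.trans_apply, IsometryEquiv.symm_apply_apply]
    obtain ⟨m, hm⟩ := hT y
    obtain ⟨m', hm'⟩ := hT₀ y
    have h1 := hm.coherent hm'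
    rw [dist_chainIdx] at h1
    rw [dist_self, zero_sub, abs_neg, abs_of_nonneg dist_nonneg, dist_self] at h1
    refine h1.trans (mul_le_mul_of_nonneg_left (max_le hε ?_) zero_le_two)
    refine (dist_pi_le_iff hε).2 fun a => ?_
    rw [← (S.isometry_toLimit hκ M).dist_eq, hu', hv', dist_comm]
    exact h _

end IsoSystem

/-! ### Finite sequences, finite subspaces and near-isometric tuples. -/

/-- The `m`-th coordinate of a list of real numbers, truncated to `[0, 1]`. -/
noncomputable def listCoord (m : ℕ) (l : List ℝ) : ℝ := max 0 (min 1 (l.getD m 0))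

lemma listCoord_mem_Icc (m : ℕ) (l : List ℝ) : listCoord m l ∈ Set.Icc (0 : ℝ) 1 :=
  ⟨le_max_left _ _, max_le zero_le_one (min_le_left _ _)⟩

lemma abs_listCoord_sub_le (m : ℕ) (l l' : List ℝ) :
    |listCoord m l - listCoord m l'| ≤ |l.getD m 0 - l'.getD m 0| := by
  unfold listCoord
  refine (abs_max_sub_max_le_max _ _ _ _).trans ?_
  rw [sub_self, abs_zero, max_eq_right (abs_nonneg _)]
  refine (abs_min_sub_min_le_max _ _ _ _).trans ?_
  rw [sub_self, abs_zero, max_eq_right (abs_nonneg _)]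

/-- `L` contains a copy of the space of finite sequences in `[0, 1]` with the sup distance. -/
def ContainsSequences (L : Type*) [MetricSpace L] : Prop :=
  ∃ e : List ℝ → L, ∀ l l', dist (e l) (e l') = ⨆ m, |listCoord m l - listCoord m l'|

/-- A finite family of `[0, 1]`-valued functions defines a map to a space containing the finite
sequences. -/
lemma ContainsSequences.exists_map {L ι : Type*} [MetricSpace L] (hL : ContainsSequences L) {N : ℕ}
    (φ : Fin N → ι → ℝ) (hφ : ∀ c i, φ c i ∈ Set.Icc (0 : ℝ) 1) :
    ∃ p : ι → L, (∀ c i j, |φ c i - φ c j| ≤ dist (p i) (p j)) ∧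
      ∀ i j (r : ℝ), 0 ≤ r → (∀ c, |φ c i - φ c j| ≤ r) → dist (p i) (p j) ≤ r := by
  obtain ⟨e, he⟩ := hL
  let l : ι → List ℝ := fun i => List.ofFn fun c => φ c i
  have hl : ∀ (c : Fin N) i, listCoord c (l i) = φ c i := fun c i => by
    have : (l i).getD c 0 = φ c i := by simp [l, List.getD_eq_getElem?_getD]
    rw [listCoord, this, min_eq_right (hφ c i).2, max_eq_right (hφ c i).1]
  have hl' : ∀ m i, N ≤ m → listCoord m (l i) = 0 := fun m i hm => by
    have : (l i).getD m 0 = 0 := List.getD_eq_default _ _ (by simpa [l] using hm)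
    rw [listCoord, this]
    simp
  refine ⟨fun i => e (l i), fun c i j => ?_, fun i j r hr h => ?_⟩
  · rw [he, ← hl, ← hl]
    exact FamilySpace.abs_sub_le_dist (F := listCoord) (hF := listCoord_mem_Icc) (c : ℕ) _ _
  · rw [he]
    refine Real.iSup_le (fun m => ?_) hr
    by_cases hm : m < N
    · simpa only [← hl] using h ⟨m, hm⟩
    · rw [hl' m i (not_lt.1 hm), hl' m j (not_lt.1 hm)]
      simpa using hr

/-- A space containing the finite sequences contains every finite metric space of diameter at most
`1`. -/
lemma ContainsSequences.exists_isometric {L : Type*} [MetricSpace L] (hL : ContainsSequences L)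
    {F : Type*} [MetricSpace F] [Finite F] (hF : ∀ x y : F, dist x y ≤ 1) :
    ∃ p : F → L, Isometry p := by
  obtain ⟨N, ⟨s⟩⟩ := Finite.exists_equiv_fin F
  -- The Kuratowski embedding: the coordinates are the distances to the points of `F`.
  obtain ⟨p, h1, h2⟩ := hL.exists_map (fun c x => dist x (s.symm c))
    fun c x => ⟨dist_nonneg, hF _ _⟩
  refine ⟨p, Isometry.of_dist_eq fun x y => le_antisymm
    (h2 x y _ dist_nonneg fun c => abs_dist_sub_le _ _ _) ?_⟩
  have := h1 (s y) x y
  rwa [Equiv.symm_apply_apply, dist_self, sub_zero, abs_of_nonneg dist_nonneg] at this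

/-- In a homogeneous space containing the finite sequences, a tuple that is almost isometric to
another one is close to a tuple that is isometric to it. -/
lemma IsUniformlyHomogeneous.exists_near {L : Type*} [MetricSpace L]
    (hom : IsUniformlyHomogeneous L) (hL : ContainsSequences L) (hd : ∀ x y : L, dist x y ≤ 1)
    {k : ℕ} (y z : Fin k → L) {δ : ℝ} (hδ : 0 ≤ δ)
    (h : ∀ a b, |dist (y a) (y b) - dist (z a) (z b)| ≤ 2 * δ) :
    ∃ w : Fin k → L, (∀ a b, dist (w a) (w b) = dist (y a) (y b)) ∧
      ∀ a, dist (w a) (z a) ≤ δ := by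
  have key : ∀ (y z : Fin k → L), (∀ a b, |dist (y a) (y b) - dist (z a) (z b)| ≤ 2 * δ) →
      ∀ c, ∃ f : L → ℝ, (∀ p, f p ∈ Set.Icc (0 : ℝ) 1) ∧ (∀ p q, f p - f q ≤ dist p q) ∧
        ∀ a, |f (y a) - dist (z a) (z c)| ≤ δ := fun y z h c => by
    refine exists_lipschitz_of_tolerance y (fun a => dist (z a) (z c)) (fun _ => δ)
      (fun _ => ⟨dist_nonneg, hd _ _⟩) (fun _ => hδ) fun a b => ?_
    linarith [dist_triangle (z a) (z b) (z c), (abs_le.1 (h a b)).1]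
  choose f hf hf' hfz using key y z h
  choose g hg hg' hgy using key z y fun a b => by
    rw [abs_sub_comm]
    exact h a b
  have abs_le : ∀ {f : L → ℝ}, (∀ p q, f p - f q ≤ dist p q) → ∀ p q, |f p - f q| ≤ dist p q :=
    fun h p q => abs_sub_le_iff.2 ⟨h p q, (h q p).trans_eq (dist_comm _ _)⟩
  -- These coordinates amalgamate the two tuples: each is embedded by the distances to its own
  -- points, and the Lipschitz functions `f c`, `g c` extend these to the other tuple with error
  -- `δ`, so that corresponding points are `δ`-close.
  obtain ⟨p, h1, h2⟩ := hL.exists_map (N := k + k) (ι := Fin k ⊕ Fin k)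
    (fun c => Fin.addCases (motive := fun _ => Fin k ⊕ Fin k → ℝ)
      (fun c => Sum.elim (fun a => dist (z a) (z c)) fun a => f c (y a))
      (fun c => Sum.elim (fun a => g c (z a)) fun a => dist (y a) (y c)) c) (by
      intro c i
      refine Fin.addCases (fun c => ?_) (fun c => ?_) c <;> rcases i with a | a <;>
        simp only [Fin.addCases_left, Fin.addCases_right, Sum.elim_inl, Sum.elim_inr]
      exacts [⟨dist_nonneg, hd _ _⟩, hf _ _, hg _ _, ⟨dist_nonneg, hd _ _⟩])
  have hz : ∀ a b, dist (p (.inl a)) (p (.inl b)) = dist (z a) (z b) := fun a b => by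
    refine le_antisymm (h2 _ _ _ dist_nonneg fun c => ?_) ?_
    · refine Fin.addCases (fun c => ?_) (fun c => ?_) c <;>
        simp only [Fin.addCases_left, Fin.addCases_right, Sum.elim_inl]
      exacts [abs_dist_sub_le _ _ _, abs_le (hg' c) _ _]
    · have := h1 (Fin.castAdd k b) (.inl a) (.inl b)
      simp only [Fin.addCases_left, Sum.elim_inl] at this
      rwa [dist_self, sub_zero, abs_of_nonneg dist_nonneg] at this
  have hy : ∀ a b, dist (p (.inr a)) (p (.inr b)) = dist (y a) (y b) := fun a b => by
    refine le_antisymm (h2 _ _ _ dist_nonneg fun c => ?_) ?_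
    · refine Fin.addCases (fun c => ?_) (fun c => ?_) c <;>
        simp only [Fin.addCases_left, Fin.addCases_right, Sum.elim_inr]
      exacts [abs_le (hf' c) _ _, abs_dist_sub_le _ _ _]
    · have := h1 (Fin.natAdd k b) (.inr a) (.inr b)
      simp only [Fin.addCases_right, Sum.elim_inr] at this
      rwa [dist_self, sub_zero, abs_of_nonneg dist_nonneg] at this
  have hyz : ∀ a, dist (p (.inr a)) (p (.inl a)) ≤ δ := fun a => by
    refine h2 _ _ _ hδ fun c => ?_
    refine Fin.addCases (fun c => ?_) (fun c => ?_) c <;>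
      simp only [Fin.addCases_left, Fin.addCases_right, Sum.elim_inl, Sum.elim_inr]
    · exact hfz c a
    · rw [abs_sub_comm]
      exact hgy c a
  -- Homogeneity brings the copy of `z` back to `z`, and the copy of `y` with it.
  obtain ⟨T, hT, -⟩ := hom k (fun a => p (.inl a)) z hz
  refine ⟨fun a => T (p (.inr a)), fun a b => by rw [T.dist_eq, hy], fun a => ?_⟩
  rw [← hT a, T.dist_eq]
  exact hyz a

/-! ### Homogeneity and the Urysohn property of the completion. -/

open UniformSpace in
/-- The extension of an isometry to the completion. -/
lemma exists_completion_isometryEquiv {L : Type*} [MetricSpace L] (g : L ≃ᵢ L) :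
    ∃ T : Completion L ≃ᵢ Completion L, ∀ x : L, T x = g x := by
  have hiso : ∀ g : L ≃ᵢ L, Isometry (Completion.map g) := fun g =>
    g.isometry.completion_map
  have hinv : ∀ g h : L ≃ᵢ L, (∀ x, g (h x) = x) → ∀ p, Completion.map g (Completion.map h p) = p :=
    fun g h hgh p => by
      have := congrFun (Completion.map_comp g.isometry.uniformContinuous
        h.isometry.uniformContinuous) p
      rw [Function.comp_apply] at this
      rw [this, show (g ∘ h : L → L) = id from funext hgh, Completion.map_id, id]
  exact ⟨IsometryEquiv.mk ⟨Completion.map g, Completion.map g.symm,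
    hinv _ _ g.symm_apply_apply, hinv _ _ g.apply_symm_apply⟩ (hiso g),
    fun x => Completion.map_coe g.isometry.uniformContinuous x⟩

namespace IsUniformlyHomogeneous

open UniformSpace Filter

variable {L : Type u} [MetricSpace L]

lemma completion_dist_le_one (hd : ∀ x y : L, dist x y ≤ 1) (p q : Completion L) :
    dist p q ≤ 1 := by
  refine Completion.induction_on₂ p q (isClosed_le continuous_dist continuous_const) fun x y => ?_
  rw [Completion.dist_eq]
  exact hd x y

/-- Isometric tuples of the completion are mapped approximately to each other by an isometry that
moves points by a controlled amount. -/
lemma completion_exists_approx (hom : IsUniformlyHomogeneous L) (hL : ContainsSequences L)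
    (hd : ∀ x y : L, dist x y ≤ 1) {k : ℕ} (u v : Fin k → Completion L)
    (huv : ∀ a b, dist (u a) (u b) = dist (v a) (v b)) {ε η : ℝ} (hε : 0 ≤ ε) (hη : 0 < η)
    (hε' : ∀ a, dist (u a) (v a) ≤ ε) :
    ∃ T : Completion L ≃ᵢ Completion L, (∀ a, dist (T (u a)) (v a) ≤ η) ∧
      ∀ p, dist (T p) p ≤ 2 * (ε + η) := by
  have approx : ∀ p : Completion L, ∃ x : L, dist p x < η / 4 := fun p =>
    Completion.denseRange_coe.exists_dist_lt p (by positivity)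
  choose y hy using fun a => approx (u a)
  choose z hz using fun a => approx (v a)
  -- Four errors of `η / 4` make the distances in `y` and `z` differ by at most `η = 2 * (η / 2)`.
  obtain ⟨w, hw, hwz⟩ := hom.exists_near hL hd y z (δ := η / 2) (by positivity) fun a b => by
    have h1 := dist_dist_dist_le (u a) (u b) (y a : Completion L) (y b)
    have h2 := dist_dist_dist_le (v a) (v b) (z a : Completion L) (z b)
    rw [Completion.dist_eq, Real.dist_eq, abs_le] at h1 h2
    have := huv a b
    rw [abs_le]
    constructor <;> linarith [hy a, hy b, hz a, hz b]
  obtain ⟨g, hg, hg'⟩ := hom k y w fun a b => (hw a b).symm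
  obtain ⟨T, hT⟩ := exists_completion_isometryEquiv g
  have hwz' : ∀ a, dist (w a : Completion L) (z a) ≤ η / 2 := fun a =>
    (Completion.dist_eq _ _).trans_le (hwz a)
  refine ⟨T, fun a => ?_, fun p => ?_⟩
  · have h1 := T.dist_eq (u a) (y a)
    rw [hT, hg] at h1
    have h2 := dist_triangle4 (T (u a)) (w a) (z a) (v a)
    rw [dist_comm (z a : Completion L)] at h2
    linarith [hy a, hz a, hwz' a]
  · refine Completion.induction_on p (isClosed_le (T.continuous.dist continuous_id)
      continuous_const) fun x => ?_
    rw [hT, Completion.dist_eq]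
    refine hg' (ε + η) (by positivity) (fun a => ?_) x
    rw [← Completion.dist_eq]
    have h1 := dist_triangle4 (y a : Completion L) (u a) (v a) (w a)
    have h2 := dist_triangle_right (v a) (w a : Completion L) (z a)
    rw [dist_comm _ (u a)] at h1
    linarith [hy a, hz a, hwz' a, hε' a]

/-- Isometries between finite families of points of the completion extend to isometries. -/
lemma completion_exists_isometryEquiv (hom : IsUniformlyHomogeneous L)
    (hL : ContainsSequences L) (hd : ∀ x y : L, dist x y ≤ 1) {k : ℕ} (u v : Fin k → Completion L)
    (huv : ∀ a b, dist (u a) (u b) = dist (v a) (v b)) :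
    ∃ T : Completion L ≃ᵢ Completion L, ∀ a, T (u a) = v a := by
  let A := Completion L ≃ᵢ Completion L
  let C : ℕ → A → Prop := fun n P => ∀ a, dist (P (u a)) (v a) ≤ (1 / 2) ^ n
  -- A correction moves points by at most `2 * (2⁻ⁿ + 2⁻ⁿ⁻¹) ≤ 4 * 2⁻ⁿ`. As it is composed on the
  -- left of `P`, the inverses are controlled as well; their convergence gives surjectivity of the
  -- limit.
  have step : ∀ n (P : A), C n P → ∃ P' : A, C (n + 1) P' ∧
      (∀ p, dist (P p) (P' p) ≤ 4 * (1 / 2) ^ n) ∧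
      ∀ p, dist (P.symm p) (P'.symm p) ≤ 4 * (1 / 2) ^ n := fun n P hP => by
    obtain ⟨T, hT, hT'⟩ := completion_exists_approx hom hL hd (fun a => P (u a)) v
      (fun a b => by rw [P.dist_eq, huv]) (ε := (1 / 2) ^ n) (η := (1 / 2) ^ (n + 1))
      (by positivity) (by positivity) hP
    have hle : 2 * ((1 / 2 : ℝ) ^ n + (1 / 2) ^ (n + 1)) ≤ 4 * (1 / 2) ^ n := by
      rw [pow_succ]
      linarith [pow_pos (one_half_pos (α := ℝ)) n]
    refine ⟨P.trans T, hT, fun p => ?_, fun p => ?_⟩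
    · rw [dist_comm]
      exact (hT' _).trans hle
    · obtain ⟨q, rfl⟩ := T.surjective p
      change dist (P.symm (T q)) (P.symm (T.symm (T q))) ≤ _
      rw [P.symm.dist_eq, T.symm_apply_apply]
      exact (hT' _).trans hle
  choose! next hnext using step
  let P : ℕ → A := fun n => Nat.rec (IsometryEquiv.refl _) next n
  have hC : ∀ n, C n (P n) := fun n => by
    induction n with
    | zero => exact fun a => (completion_dist_le_one hd _ _).trans_eq (pow_zero _).symm
    | succ n ih => exact (hnext n _ ih).1
  have lim : ∀ p, ∃ q, Tendsto (fun n => P n p) atTop (𝓝 q) := fun p =>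
    cauchySeq_tendsto_of_complete
      (cauchySeq_of_le_geometric (1 / 2) 4 (by norm_num) fun n => (hnext n _ (hC n)).2.1 p)
  have lim' : ∀ p, ∃ q, Tendsto (fun n => (P n).symm p) atTop (𝓝 q) := fun p =>
    cauchySeq_tendsto_of_complete
      (cauchySeq_of_le_geometric (1 / 2) 4 (by norm_num) fun n => (hnext n _ (hC n)).2.2 p)
  choose F hF using lim
  choose F' hF' using lim'
  have hiso : Isometry F := Isometry.of_dist_eq fun p q =>
    tendsto_nhds_unique (((hF p).dist (hF q)).congr fun n => (P n).dist_eq p q)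
      tendsto_const_nhds
  have hsurj : Function.Surjective F := fun q => by
    refine ⟨F' q, tendsto_nhds_unique (hF (F' q)) (tendsto_iff_dist_tendsto_zero.2 ?_)⟩
    have := tendsto_iff_dist_tendsto_zero.1 (hF' q)
    refine this.congr fun n => ?_
    rw [← (P n).dist_eq, IsometryEquiv.apply_symm_apply, dist_comm]
  refine ⟨IsometryEquiv.mk (Equiv.ofBijective F ⟨hiso.injective, hsurj⟩) hiso, fun a => ?_⟩
  exact tendsto_nhds_unique (hF (u a)) (tendsto_iff_dist_tendsto_zero.2
    (squeeze_zero (fun _ => dist_nonneg) (fun n => hC n a)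
      (tendsto_pow_atTop_nhds_zero_of_lt_one (by norm_num) (by norm_num))))

theorem isOmegaHomogeneous_completion (hom : IsUniformlyHomogeneous L)
    (hL : ContainsSequences L) (hd : ∀ x y : L, dist x y ≤ 1) :
    IsOmegaHomogeneous (Completion L) := by
  intro A B hA _ f
  have := hA.to_subtype
  obtain ⟨k, ⟨e⟩⟩ := Finite.exists_equiv_fin A
  obtain ⟨T, hT⟩ := completion_exists_isometryEquiv hom hL hd (fun a => (e.symm a : Completion L))
    (fun a => (f (e.symm a) : Completion L)) fun a b => by
      rw [← Subtype.dist_eq, ← Subtype.dist_eq, f.dist_eq]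
  refine ⟨T, fun a => ?_⟩
  have := hT (e a)
  rwa [e.symm_apply_apply] at this

/-- The finite space `L` has a copy somewhere; an isometry taking the copy of `K` to its prescribed
image carries the whole copy to an extension. -/
theorem isUrysohn_completion (hom : IsUniformlyHomogeneous L)
    (hL : ContainsSequences L) (hd : ∀ x y : L, dist x y ≤ 1) :
    IsUrysohn (Completion L) := by
  constructor
  · refine le_antisymm (Metric.diam_le_of_forall_dist_le zero_le_one fun p _ q _ =>
      completion_dist_le_one hd p q) ?_
    obtain ⟨p, h1, -⟩ := hL.exists_map (N := 1) (ι := Bool) (fun _ b => if b then 1 else 0)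
      (by rintro c (_ | _) <;> simp)
    have h2 : (1 : ℝ) ≤ dist (p true : Completion L) (p false) := by
      rw [Completion.dist_eq]
      simpa using h1 0 true false
    exact h2.trans (Metric.dist_le_diam_of_mem
      (Metric.isBounded_iff.2 ⟨1, fun p _ q _ => completion_dist_le_one hd p q⟩)
      (Set.mem_univ _) (Set.mem_univ _))
  · intro F _ _ hF K f hf
    obtain ⟨h, hh⟩ := hL.exists_isometric (F := F) fun x y =>
      (Metric.dist_le_diam_of_mem (Set.finite_univ.isBounded) (Set.mem_univ x)
        (Set.mem_univ y)).trans hF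
    have h' : Isometry fun x => (h x : Completion L) := Completion.coe_isometry.comp hh
    obtain ⟨k, ⟨e⟩⟩ := Finite.exists_equiv_fin K
    obtain ⟨T, hT⟩ := completion_exists_isometryEquiv hom hL hd
      (fun a => (h (e.symm a) : Completion L)) (fun a => f (e.symm a)) fun a b => by
        rw [hf.dist_eq, h'.dist_eq, Subtype.dist_eq]
    refine ⟨fun x => T (h x), T.isometry.comp h', fun x => ?_⟩
    have := hT (e x)
    rwa [e.symm_apply_apply] at this

end IsUniformlyHomogeneous

/-! ### The seed space of a topological group. -/

open Pointwise Uniformity in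
/-- Every neighbourhood of `1` in a topological group contains the set where some left uniformly
continuous function with values in `[0, 1]`, vanishing at `1`, is less than `1`. -/
lemma exists_leftUniformContinuous {G : Type*} [Group G] [TopologicalSpace G]
    [IsTopologicalGroup G] {U : Set G} (hU : U ∈ 𝓝 (1 : G)) :
    ∃ f : G → ℝ, (∀ g, f g ∈ Set.Icc (0 : ℝ) 1) ∧ f 1 = 0 ∧ (∀ g, f g < 1 → g ∈ U) ∧
      ∀ ε > 0, ∀ᶠ k in 𝓝 (1 : G), ∀ b, |f (b * k) - f b| < ε := by
  have step : ∀ V : {V : Set G // V ∈ 𝓝 1}, ∃ V' : {V : Set G // V ∈ 𝓝 1},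
      V'.1⁻¹ = V'.1 ∧ V'.1 * V'.1 ⊆ V.1 := fun V =>
    let ⟨V', h1, _, h2, h3⟩ := exists_closed_nhds_one_inv_eq_mul_subset V.2
    ⟨⟨V', h1⟩, h2, h3⟩
  choose next hinv hmul using step
  let V : ℕ → {V : Set G // V ∈ 𝓝 (1 : G)} := fun n => Nat.rec (next ⟨U, hU⟩) (fun _ => next) n
  have hVinv : ∀ n, (V n).1⁻¹ = (V n).1 := by rintro (_ | n) <;> exact hinv _
  have hVmul : ∀ n, (V (n + 1)).1 * (V (n + 1)).1 ⊆ (V n).1 := fun n => hmul (V n)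
  have hV1 : ∀ n, (1 : G) ∈ (V n).1 := fun n => mem_of_mem_nhds (V n).2
  have hVsucc : ∀ n, (V (n + 1)).1 ⊆ (V n).1 := fun n x hx =>
    hVmul n (by simpa using Set.mul_mem_mul hx (hV1 (n + 1)))
  have hV0 : (V 0).1 ⊆ U := fun x hx => by
    refine hmul ⟨U, hU⟩ ?_
    have := Set.mul_mem_mul hx (hV1 0)
    rwa [mul_one] at this
  -- These left-invariant entourages generate a pseudometrizable uniformity. Their invariance makes
  -- the final estimate uniform in `b`, because `b⁻¹ * (b * k) = k`.
  let W : ℕ → Set (G × G) := fun n => {p | p.1⁻¹ * p.2 ∈ (V n).1}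
  have hW : Antitone W := antitone_nat_of_succ_le fun n p hp => hVsucc n hp
  have hbasis : (⨅ n, Filter.principal (W n)).HasBasis (fun _ => True) W :=
    Filter.hasBasis_iInf_principal hW.directed_ge
  let core : UniformSpace.Core G :=
    { uniformity := ⨅ n, Filter.principal (W n)
      refl := hbasis.ge_iff.2 fun n _ => by
        rintro ⟨x, y⟩ h
        obtain rfl : x = y := h
        simpa [W] using hV1 n
      symm := (hbasis.tendsto_iff hbasis).2 fun n _ => ⟨n, trivial, fun p hp => by
        have : (p.1⁻¹ * p.2)⁻¹ ∈ (V n).1 := by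
          rw [← Set.mem_inv, hVinv]
          exact hp
        simpa [W] using this⟩
      comp := ((hbasis.lift' (monotone_id.relComp monotone_id)).le_basis_iff hbasis).2
        fun n _ => ⟨n + 1, trivial, by
          rintro ⟨x, z⟩ ⟨y, h1, h2⟩
          have := hVmul n (Set.mul_mem_mul h1 h2)
          simpa [W, mul_assoc] using this⟩ }
  let us : UniformSpace G := .ofCore core
  have hus : (𝓤 G).HasBasis (fun _ => True) W := hbasis
  have : (𝓤 G).IsCountablyGenerated := hus.isCountablyGenerated
  obtain ⟨I, hI⟩ := UniformSpace.metrizable_uniformity G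
  have hI' : 𝓤[I.toUniformSpace] = 𝓤[us] := by rw [hI]
  have hsub : ∀ x y z : G, |dist x z - dist y z| ≤ dist x y := abs_dist_sub_le
  obtain ⟨r, hr, hrV⟩ : ∃ r > 0, ∀ x y : G, dist x y < r → x⁻¹ * y ∈ (V 0).1 := by
    have h : W 0 ∈ 𝓤[I.toUniformSpace] := by
      rw [hI']
      exact hus.mem_of_mem (i := 0) trivial
    obtain ⟨r, hr, h⟩ := Metric.mem_uniformity_dist.1 h
    exact ⟨r, hr, fun x y hxy => h hxy⟩
  have hd : ∀ ε > 0, ∃ n, ∀ x y : G, x⁻¹ * y ∈ (V n).1 → dist x y < ε := fun ε hε => by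
    have h := hI' ▸ Metric.dist_mem_uniformity (α := G) hε
    obtain ⟨n, -, hn⟩ := hus.mem_iff.1 h
    exact ⟨n, fun x y hxy => hn (a := (x, y)) hxy⟩
  refine ⟨fun g => min 1 (dist g 1 / r), fun g =>
    ⟨le_min zero_le_one (div_nonneg dist_nonneg hr.le), min_le_left _ _⟩, by simp, fun g hg => ?_,
    fun ε hε => ?_⟩
  · have h1 : dist g 1 < r := by
      rcases min_lt_iff.1 hg with h | h
      · exact absurd h (lt_irrefl _)
      · rwa [div_lt_one hr] at h
    rw [dist_comm] at h1
    have := hrV 1 g h1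
    rw [inv_one, one_mul] at this
    exact hV0 this
  · obtain ⟨n, hn⟩ := hd (ε * r) (by positivity)
    filter_upwards [(V n).2] with k hk b
    refine (abs_min_sub_min_le_max _ _ _ _).trans_lt ?_
    rw [sub_self, abs_zero, max_eq_right (abs_nonneg _), ← sub_div, abs_div, abs_of_pos hr,
      div_lt_iff₀ hr]
    refine (hsub _ _ _).trans_lt ?_
    rw [dist_comm]
    exact hn _ _ (by simpa using hk)

/-- The disjoint union of copies of a group indexed by `ι` and of the set of finite sequences of
real numbers. -/
inductive Seed (G ι : Type u) : Type u
  | grp (i : ι) (g : G)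
  | seq (l : List ℝ)

namespace Seed

variable {G ι : Type u} [Group G]

instance : MulAction G (Seed G ι) where
  smul g
    | .grp i h => .grp i (g * h)
    | .seq l => .seq l
  one_smul := by
    rintro (⟨i, g⟩ | l)
    · exact congrArg (grp i) (one_mul _)
    · rfl
  mul_smul g h := by
    rintro (⟨i, g⟩ | l)
    · exact congrArg (grp i) (mul_assoc _ _ _)
    · rfl

lemma smul_grp (g : G) (i : ι) (h : G) : g • grp i h = grp i (g * h) := rfl

open Classical in
/-- The functions defining the distance of `Seed G ι`: left translates of the functions `f i` on
the copies of the group, and coordinates on the set of finite sequences. -/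
noncomputable def family (f : ι → G → ℝ) : (ι × G) ⊕ ℕ → Seed G ι → ℝ
  | .inl q, .grp i g => if i = q.1 then f i (q.2 * g) else 0
  | .inr m, .seq l => listCoord m l
  | _, _ => 0

variable {f : ι → G → ℝ}

lemma family_mem_Icc (hf : ∀ i g, f i g ∈ Set.Icc (0 : ℝ) 1) :
    ∀ t p, family f t p ∈ Set.Icc (0 : ℝ) 1 := by
  have h0 : (0 : ℝ) ∈ Set.Icc (0 : ℝ) 1 := ⟨le_rfl, zero_le_one⟩
  rintro (q | m) (⟨i, g⟩ | l)
  · simp only [family]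
    split_ifs
    exacts [hf _ _, h0]
  exacts [h0, h0, listCoord_mem_Icc _ _]

variable (hf : ∀ i g, f i g ∈ Set.Icc (0 : ℝ) 1)

/-- The action permutes the family: translating by `g` turns the translate of `f i` by `a` into its
translate by `a * g`. -/
instance (h : ∀ t p, family f t p ∈ Set.Icc (0 : ℝ) 1) :
    IsIsometricSMul G (FamilySpace (family f) h) := by
  refine FamilySpace.isIsometricSMul fun g t => ?_
  rcases t with q | m
  · refine ⟨.inl (q.1, q.2 * g), ?_⟩
    rintro (⟨i, h⟩ | l)
    · simp only [smul_grp, family, mul_assoc]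
    · rfl
  · exact ⟨.inr m, by rintro (⟨i, h⟩ | l) <;> rfl⟩

/-- The metric space associated with `Seed G ι`. -/
abbrev Space : Type u := SeparationQuotient (FamilySpace (family f) (family_mem_Icc hf))

/-- The canonical map to the metric space associated with `Seed G ι`. -/
noncomputable def toSpace (p : Seed G ι) : Space hf := SeparationQuotient.mk (FamilySpace.of _ p)

lemma exists_toSpace_eq (p : Space hf) : ∃ q, toSpace hf q = p := SeparationQuotient.surjective_mk p

lemma smul_toSpace (g : G) (p : Seed G ι) : g • toSpace hf p = toSpace hf (g • p) := rfl

lemma dist_toSpace (p q : Seed G ι) : dist (toSpace hf p) (toSpace hf q) =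
    dist (FamilySpace.of (family_mem_Icc hf) p) (FamilySpace.of (family_mem_Icc hf) q) :=
  SeparationQuotient.dist_mk _ _

lemma dist_le_one (p q : Space hf) : dist p q ≤ 1 := by
  obtain ⟨p, rfl⟩ := exists_toSpace_eq hf p
  obtain ⟨q, rfl⟩ := exists_toSpace_eq hf q
  rw [dist_toSpace]
  exact FamilySpace.dist_le_one _ _

lemma dist_toSpace_seq (l l' : List ℝ) : dist (toSpace hf (.seq l)) (toSpace hf (.seq l')) =
    ⨆ m, |listCoord m l - listCoord m l'| := by
  rw [dist_toSpace]
  refine le_antisymm (FamilySpace.dist_le (Real.iSup_nonneg fun _ => abs_nonneg _) ?_)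
    (Real.iSup_le (fun m => ?_) dist_nonneg)
  · rintro (q | m)
    · simp only [family, sub_zero, abs_zero]
      exact Real.iSup_nonneg fun _ => abs_nonneg _
    · exact FamilySpace.abs_sub_le_dist (F := listCoord) (hF := listCoord_mem_Icc) m _ _
  · exact FamilySpace.abs_sub_le_dist (F := family f) (hF := family_mem_Icc hf) (.inr m) (.seq l)
      (.seq l')

lemma containsSequences : ContainsSequences (Space hf) :=
  ⟨fun l => toSpace hf (.seq l), fun _ _ => dist_toSpace_seq hf _ _⟩

lemma le_dist_toSpace_grp (i : ι) (g h : G) :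
    |f i g - f i h| ≤ dist (toSpace hf (.grp i g)) (toSpace hf (.grp i h)) := by
  rw [dist_toSpace]
  have := FamilySpace.abs_sub_le_dist (F := family f) (hF := family_mem_Icc hf) (.inl (i, 1))
    (.grp i g) (.grp i h)
  simpa [family] using this

lemma dist_toSpace_grp_le (i : ι) (g h : G) {c : ℝ} (hc : 0 ≤ c)
    (H : ∀ a, |f i (a * g) - f i (a * h)| ≤ c) :
    dist (toSpace hf (.grp i g)) (toSpace hf (.grp i h)) ≤ c := by
  rw [dist_toSpace]
  refine FamilySpace.dist_le hc ?_
  rintro (q | m)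
  · simp only [family]
    split_ifs
    · exact H q.2
    · simpa using hc
  · simpa [family] using hc

variable [TopologicalSpace G] [IsTopologicalGroup G]

/-- The distance within a copy of the group is a supremum over left translates, which left uniform
continuity makes small near the diagonal. -/
lemma continuous_toSpace_grp
    (hu : ∀ i, ∀ ε > 0, ∀ᶠ k in 𝓝 (1 : G), ∀ b, |f i (b * k) - f i b| < ε) (i : ι) :
    Continuous fun g : G => toSpace hf (.grp i g) := by
  refine continuous_iff_continuousAt.2 fun g => Metric.tendsto_nhds.2 fun ε hε => ?_
  have h : Filter.Tendsto (fun h : G => g⁻¹ * h) (𝓝 g) (𝓝 1) := by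
    have : Continuous fun h : G => g⁻¹ * h := by fun_prop
    simpa using this.tendsto g
  filter_upwards [h.eventually (hu i (ε / 2) (by positivity))] with k hk
  refine (dist_toSpace_grp_le hf i k g (half_pos hε).le fun a => ?_).trans_lt (half_lt_self hε)
  have := hk (a * g)
  rw [mul_assoc, mul_inv_cancel_left] at this
  exact this.le

lemma tendsto_smul (hu : ∀ i, ∀ ε > 0, ∀ᶠ k in 𝓝 (1 : G), ∀ b, |f i (b * k) - f i b| < ε)
    (p : Space hf) : Filter.Tendsto (fun g : G => g • p) (𝓝 1) (𝓝 p) := by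
  obtain ⟨⟨i, h⟩ | l, rfl⟩ := exists_toSpace_eq hf p
  · have : Continuous fun g : G => toSpace hf (.grp i (g * h)) :=
      (continuous_toSpace_grp hf hu i).comp (continuous_mul_const h)
    have := this.tendsto 1
    rwa [one_mul] at this
  · exact tendsto_const_nhds

lemma hasDense (hu : ∀ i, ∀ ε > 0, ∀ᶠ k in 𝓝 (1 : G), ∀ b, |f i (b * k) - f i b| < ε)
    {κ : Cardinal.{u}} (hκ : ℵ₀ ≤ κ) (hι : #ι ≤ κ) (hG : HasDense κ G) :
    HasDense κ (Space hf) := by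
  obtain ⟨D, s, hD, hs⟩ := hG
  refine ⟨(ι × D) ⊕ ULift.{u} (List ℚ), fun q => toSpace hf (Sum.elim
    (fun q => .grp q.1 (s q.2)) (fun l => .seq (l.down.map (↑))) q), ?_, fun p => ?_⟩
  · rw [mk_sum, lift_id, lift_id, mk_prod, lift_id, lift_id]
    refine (add_le_add ((mul_le_mul' hι hD).trans (mul_eq_self hκ).le) ?_).trans
      (add_eq_self hκ).le
    exact mk_le_aleph0.trans hκ
  · obtain ⟨⟨i, g⟩ | l, rfl⟩ := exists_toSpace_eq hf p
    · refine map_mem_closure (f := fun g : G => toSpace hf (.grp i g))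
        (continuous_toSpace_grp hf hu i) (hs g) ?_
      rintro _ ⟨d, rfl⟩
      exact ⟨.inl (i, d), rfl⟩
    · refine Metric.mem_closure_iff.2 fun ε hε => ?_
      choose q hq using fun r : ℝ => Rat.isDenseEmbedding_coe_real.dense.exists_dist_lt r
        (half_pos hε)
      refine ⟨_, ⟨.inr ⟨l.map q⟩, rfl⟩, ?_⟩
      refine (dist_toSpace_seq hf _ _).trans_lt ((Real.iSup_le (fun m => ?_)
        (half_pos hε).le).trans_lt (half_lt_self hε))
      refine (abs_listCoord_sub_le _ _ _).trans ?_
      simp only [List.map_map, List.getD_eq_getElem?_getD, List.getElem?_map]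
      rcases l[m]? with _ | r
      · simpa using (half_pos hε).le
      · simpa [Real.dist_eq] using (hq r).le

/-- The system without partial isometries on the metric space associated with `Seed G ι`. -/
noncomputable def isoSystem
    (hu : ∀ i, ∀ ε > 0, ∀ᶠ k in 𝓝 (1 : G), ∀ b, |f i (b * k) - f i b| < ε)
    {κ : Cardinal.{u}} (hκ : ℵ₀ ≤ κ) (hι : #ι ≤ κ) (hG : HasDense κ G) : IsoSystem G κ where
  X := Space hf
  Idx := PUnit
  isoIdx := ⟨fun _ => isometry_id⟩
  dist_le_one := dist_le_one hf
  idx_dist_le_one _ _ := zero_le_one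
  tendsto_smul := tendsto_smul hf hu
  tendsto_smul_idx _ := tendsto_const_nhds
  hasDense := hasDense hf hu hκ hι hG
  hasDense_idx := ⟨PUnit, id, by simpa using one_le_aleph0.trans hκ, denseRange_id⟩
  Rel _ _ _ := False
  rel_coherent h := h.elim
  rel_smul _ _ _ _ h := h

end Seed

/-! ### Weight and density. -/

open TopologicalSpace

lemma exists_isTopologicalBasis_card_eq_weight (X : Type u) [TopologicalSpace X] :
    ∃ B : Set (Set X), IsTopologicalBasis B ∧ #B = weight X :=
  csInf_mem (s := {c : Cardinal.{u} | ∃ B : Set (Set X), IsTopologicalBasis B ∧ #B = c})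
    ⟨_, _, isTopologicalBasis_opens, rfl⟩

lemma weight_le_card {X : Type u} [TopologicalSpace X] {B : Set (Set X)}
    (hB : IsTopologicalBasis B) : weight X ≤ #B :=
  csInf_le' ⟨B, hB, rfl⟩

lemma weight_le_of_range {X ι : Type u} [TopologicalSpace X] {s : ι → Set X}
    (hs : IsTopologicalBasis (Set.range s)) : weight X ≤ #ι :=
  (weight_le_card hs).trans mk_range_le

lemma hasDense_weight (X : Type u) [TopologicalSpace X] : HasDense (weight X) X := by
  obtain ⟨B, hB, hc⟩ := exists_isTopologicalBasis_card_eq_weight X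
  refine ⟨{U : B // U.1.Nonempty}, fun U => U.2.some, ?_, ?_⟩
  · rw [← hc]
    exact mk_subtype_le _
  · refine hB.dense_iff.2 fun U hU hne => ?_
    exact ⟨_, Set.Nonempty.some_mem _, ⟨⟨⟨U, hU⟩, hne⟩, rfl⟩⟩

lemma weight_le_of_hasDense {κ : Cardinal.{u}} (hκ : ℵ₀ ≤ κ) {X : Type u} [MetricSpace X]
    (h : HasDense κ X) : weight X ≤ κ := by
  obtain ⟨ι, s, hι, hs⟩ := h
  have : IsTopologicalBasis (Set.range fun p : ι × ULift.{u} ℕ =>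
      Metric.ball (s p.1) (1 / ((p.2.down : ℝ) + 1))) := by
    refine isTopologicalBasis_of_isOpen_of_nhds ?_ fun x U hx hU => ?_
    · rintro _ ⟨p, rfl⟩
      exact Metric.isOpen_ball
    · obtain ⟨ε, hε, hU⟩ := Metric.isOpen_iff.1 hU x hx
      obtain ⟨n, hn⟩ := exists_nat_one_div_lt (half_pos hε)
      obtain ⟨i, hi⟩ := hs.exists_dist_lt x (Nat.one_div_pos_of_nat (α := ℝ) (n := n))
      refine ⟨_, ⟨(i, ⟨n⟩), rfl⟩, hi, fun y hy => hU ?_⟩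
      rw [Metric.mem_ball] at hy ⊢
      rw [dist_comm] at hi
      linarith [dist_triangle y (s i) x]
  refine (weight_le_of_range this).trans ?_
  rw [mk_prod, lift_id, lift_id]
  exact (mul_le_mul' hι (by simpa using hκ)).trans (mul_eq_self hκ).le

/-- In a T0 space a point is determined by the basic sets containing it, so a finite base allows
only finitely many points. -/
lemma aleph0_le_weight (X : Type u) [TopologicalSpace X] [T0Space X] [Infinite X] :
    ℵ₀ ≤ weight X := by
  obtain ⟨B, hB, hc⟩ := exists_isTopologicalBasis_card_eq_weight X
  rw [← hc]
  by_contra! h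
  have := lt_aleph0_iff_finite.1 h
  refine not_injective_infinite_finite (fun (x : X) => {U : B | x ∈ U.1}) fun x y hxy => ?_
  refine hB.eq_iff.2 fun U hU => ?_
  exact Set.ext_iff.1 hxy ⟨U, hU⟩

lemma weight_lt_aleph0 (X : Type u) [TopologicalSpace X] [Finite X] : weight X < ℵ₀ :=
  (weight_le_card isTopologicalBasis_opens).trans_lt (lt_aleph0_of_finite _)

/-! ### From isometric actions to embeddings in the isometry group. -/

section Action

variable {G M : Type u} [Group G] [TopologicalSpace G] [IsTopologicalGroup G] [MetricSpace M]
  [MulAction G M] [IsIsometricSMul G M]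

lemma continuous_smul_of_tendsto {p : M} (h : Filter.Tendsto (fun g : G => g • p) (𝓝 1) (𝓝 p)) :
    Continuous fun g : G => g • p := by
  refine continuous_iff_continuousAt.2 fun g => ?_
  have h1 : Filter.Tendsto (fun h : G => g⁻¹ * h) (𝓝 g) (𝓝 1) := by
    have : Continuous fun h : G => g⁻¹ * h := by fun_prop
    simpa using this.tendsto g
  have h2 := ((isometry_smul M g).continuous.tendsto p).comp (h.comp h1)
  refine h2.congr fun k => ?_
  rw [Function.comp_apply, Function.comp_apply, smul_smul, mul_inv_cancel_left]

lemma exists_dist_smul_lt_of_mem_nhds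
    (h : ∀ W ∈ 𝓝 (1 : G), ∃ p : M, ∃ ε > 0, ∀ g : G, dist (g • p) p < ε → g ∈ W) {g : G} {W : Set G}
    (hW : W ∈ 𝓝 g) : ∃ p : M, ∃ ε > 0, ∀ k : G, dist (k • p) (g • p) < ε → k ∈ W := by
  have : (fun k => g * k) ⁻¹' W ∈ 𝓝 (1 : G) := by
    refine (continuous_const_mul g).continuousAt.preimage_mem_nhds ?_
    rwa [mul_one]
  obtain ⟨p, ε, hε, H⟩ := h _ this
  refine ⟨p, ε, hε, fun k hk => ?_⟩
  have := H (g⁻¹ * k) (by rwa [mul_smul, ← dist_smul g, smul_inv_smul])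
  rwa [Set.mem_preimage, mul_inv_cancel_left] at this

/-- The sets `{g | g • s d ∈ U}`, for `s d` in a dense set and `U` in a base of `M`, form a base of
`G`; isometry of the action allows replacing a point by a nearby `s d`. -/
lemma weight_le_of_action [Infinite M]
    (hc : ∀ p : M, Filter.Tendsto (fun g : G => g • p) (𝓝 1) (𝓝 p))
    (h : ∀ W ∈ 𝓝 (1 : G), ∃ p : M, ∃ ε > 0, ∀ g : G, dist (g • p) p < ε → g ∈ W) :
    weight G ≤ weight M := by
  obtain ⟨D, s, hD, hs⟩ := hasDense_weight M
  obtain ⟨B, hB, hBc⟩ := exists_isTopologicalBasis_card_eq_weight M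
  have : IsTopologicalBasis (Set.range fun q : D × B => {g : G | g • s q.1 ∈ q.2.1}) := by
    refine isTopologicalBasis_of_isOpen_of_nhds ?_ fun g W hg hW => ?_
    · rintro _ ⟨q, rfl⟩
      exact (hB.isOpen q.2.2).preimage (continuous_smul_of_tendsto (hc _))
    · obtain ⟨p, ε, hε, H⟩ := exists_dist_smul_lt_of_mem_nhds h (hW.mem_nhds hg)
      obtain ⟨d, hd⟩ := hs.exists_dist_lt p (show 0 < ε / 3 by positivity)
      obtain ⟨U, hU, hgU, hUb⟩ := hB.exists_subset_of_mem_open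
        (Metric.mem_ball_self (x := g • s d) (show 0 < ε / 3 by positivity)) Metric.isOpen_ball
      refine ⟨_, ⟨(d, ⟨U, hU⟩), rfl⟩, hgU, fun k hk => H k ?_⟩
      have h1 : dist (k • s d) (g • s d) < ε / 3 := hUb hk
      have h2 := dist_triangle4 (k • p) (k • s d) (g • s d) (g • p)
      rw [dist_smul, dist_smul, dist_comm (s d)] at h2
      linarith
  refine (weight_le_of_range this).trans ?_
  rw [mk_prod, lift_id, lift_id, hBc]
  exact (mul_le_mul' hD le_rfl).trans (mul_eq_self (aleph0_le_weight M)).le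

/-- The homomorphism to the group of isometries defined by an isometric action. -/
def toIsometryHom : G →* (M ≃ᵢ M) where
  toFun := IsometryEquiv.constSMul
  map_one' := by ext p; exact one_smul G p
  map_mul' g h := by ext p; exact mul_smul g h p

lemma isEmbedding_toIsometryHom [T2Space G]
    (hc : ∀ p : M, Filter.Tendsto (fun g : G => g • p) (𝓝 1) (𝓝 p))
    (h : ∀ W ∈ 𝓝 (1 : G), ∃ p : M, ∃ ε > 0, ∀ g : G, dist (g • p) p < ε → g ∈ W) :
    IsEmbedding (toIsometryHom : G →* (M ≃ᵢ M)) := by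
  have hi : IsInducing fun (g : G) (p : M) => g • p := by
    refine isInducing_iff_nhds.2 fun g => le_antisymm ?_ fun W hW => ?_
    · exact (continuous_pi fun p => continuous_smul_of_tendsto (hc p)).tendsto g |>.le_comap
    · obtain ⟨p, ε, hε, H⟩ := exists_dist_smul_lt_of_mem_nhds h hW
      refine ⟨{F | dist (F p) (g • p) < ε}, ?_, fun k hk => H k hk⟩
      refine (isOpen_lt (by fun_prop) continuous_const).mem_nhds ?_
      simpa using hε
  have hiso : IsInducing fun (g : M ≃ᵢ M) (x : M) => g x := ⟨rfl⟩
  have : IsInducing (toIsometryHom : G →* (M ≃ᵢ M)) := hiso.of_comp_iff.1 hi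
  -- Injectivity comes from the separation of `G`.
  exact this.isEmbedding

end Action

/-! ### The action on the completion, and the conclusion. -/

section Completion

open UniformSpace Filter

variable {G L : Type u} [Group G] [TopologicalSpace G] [MetricSpace L] [MulAction G L]
  [IsIsometricSMul G L]

instance IsIsometricSMul.uniformContinuousConstSMul : UniformContinuousConstSMul G L :=
  ⟨fun g => (isometry_smul L g).uniformContinuous⟩

instance UniformSpace.Completion.isIsometricSMul : IsIsometricSMul G (Completion L) :=
  ⟨fun g => (isometry_smul L g).completion_map⟩

lemma tendsto_smul_completion (hc : ∀ p : L, Tendsto (fun g : G => g • p) (𝓝 1) (𝓝 p))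
    (p : Completion L) : Tendsto (fun g : G => g • p) (𝓝 1) (𝓝 p) := by
  refine Metric.tendsto_nhds.2 fun ε hε => ?_
  obtain ⟨x, hx⟩ := Completion.denseRange_coe.exists_dist_lt p (show 0 < ε / 3 by positivity)
  filter_upwards [Metric.tendsto_nhds.1 (hc x) (ε / 3) (by positivity)] with g hg
  have h1 := dist_triangle4 (g • p) (g • (x : Completion L)) x p
  rw [dist_smul, ← Completion.coe_smul, Completion.dist_eq, dist_comm (x : Completion L) p] at h1
  linarith

lemma HasDense.completion {κ : Cardinal.{u}} (h : HasDense κ L) : HasDense κ (Completion L) :=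
  h.map (Completion.continuous_coe L) Completion.denseRange_coe

end Completion

/-- A topological group acts isometrically, with continuous orbit maps, on a metric space that is
homogeneous, contains the finite sequences and has a small dense subset, in such a way that the
action determines the topology of the group. -/
lemma exists_homogeneous_action (G : Type u) [Group G] [TopologicalSpace G] [IsTopologicalGroup G]
    {κ : Cardinal.{u}} (hκ : ℵ₀ ≤ κ) (hG : weight G ≤ κ) :
    ∃ (L : Type u) (_ : MetricSpace L) (_ : MulAction G L) (_ : IsIsometricSMul G L),
      IsUniformlyHomogeneous L ∧ ContainsSequences L ∧ (∀ x y : L, dist x y ≤ 1) ∧ HasDense κ L ∧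
      (∀ p : L, Filter.Tendsto (fun g : G => g • p) (𝓝 1) (𝓝 p)) ∧
      ∀ W ∈ 𝓝 (1 : G), ∃ p : L, ∃ ε > 0, ∀ g : G, dist (g • p) p < ε → g ∈ W := by
  obtain ⟨B, hB, hBc⟩ := exists_isTopologicalBasis_card_eq_weight G
  -- One copy of the group for each basic neighbourhood of `1`, hence at most `κ` copies.
  let ι := {U : B // (1 : G) ∈ U.1}
  have hι : #ι ≤ κ := (mk_subtype_le _).trans (hBc.trans_le hG)
  choose f hf hf1 hfU hfu using fun U : ι =>
    exists_leftUniformContinuous ((hB.isOpen U.1.2).mem_nhds U.2)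
  have hd : HasDense κ G := by
    obtain ⟨D, s, hD, hs⟩ := hasDense_weight G
    exact ⟨D, s, hD.trans hG, hs⟩
  let S := Seed.isoSystem hf hfu hκ hι hd
  have hS : ∀ (g : G) (p : Seed.Space hf), g • S.toLimit hκ 0 p = S.toLimit hκ 0 (g • p) :=
    fun g p => S.smul_toLimit hκ g 0 p
  have hS' : Isometry fun p : Seed.Space hf => S.toLimit hκ 0 p := S.isometry_toLimit hκ 0
  refine ⟨S.Limit hκ, inferInstance, inferInstance, inferInstance,
    S.isUniformlyHomogeneous_limit hκ, ?_, S.limit_dist_le_one hκ, S.hasDense_limit hκ,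
    S.limit_tendsto_smul hκ, fun W hW => ?_⟩
  · obtain ⟨e, he⟩ := Seed.containsSequences hf
    exact ⟨fun l => S.toLimit hκ 0 (e l), fun l l' => (hS'.dist_eq _ _).trans (he l l')⟩
  · obtain ⟨U, hU, h1, hUW⟩ := hB.mem_nhds_iff.1 hW
    let i : ι := ⟨⟨U, hU⟩, h1⟩
    -- The identity of the `i`-th copy detects `U`: it is moved by `g` at least by `f i g`, which is
    -- below `1` only on `U`.
    refine ⟨S.toLimit hκ 0 (Seed.toSpace hf (.grp i 1)), 1, one_pos, fun g hg => hUW ?_⟩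
    rw [hS, Seed.smul_toSpace, Seed.smul_grp, mul_one] at hg
    have h2 := (Seed.le_dist_toSpace_grp hf i g 1).trans_lt ((hS'.dist_eq _ _).symm.trans_lt hg)
    rw [hf1, sub_zero] at h2
    exact hfU i g ((le_abs_self _).trans_lt h2)

theorem theorem1p4 (G : Type u) [Group G] [TopologicalSpace G] [IsTopologicalGroup G]
    [T2Space G] :
    ∃ (M : Type u) (_ : MetricSpace M),
      CompleteSpace M ∧ IsOmegaHomogeneous M ∧ IsUrysohn M ∧
      (Infinite G → weight M = weight G) ∧ (Finite G → weight M = ℵ₀) ∧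
      ∃ H : Subgroup (M ≃ᵢ M), Nonempty (G ≃ₜ* H) := by
  obtain ⟨L, _, _, _, hom, hL, hd, hdense, hc, hW⟩ := exists_homogeneous_action G
    (le_max_right (weight G) ℵ₀) (le_max_left _ _)
  have hW' : ∀ W ∈ 𝓝 (1 : G), ∃ p : UniformSpace.Completion L, ∃ ε > 0,
      ∀ g : G, dist (g • p) p < ε → g ∈ W := fun W h => by
    obtain ⟨p, ε, hε, H⟩ := hW W h
    refine ⟨p, ε, hε, fun g hg => H g ?_⟩
    rwa [← UniformSpace.Completion.coe_smul, UniformSpace.Completion.dist_eq] at hg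
  have hinf : Infinite (UniformSpace.Completion L) := by
    obtain ⟨p, h1, -⟩ := hL.exists_map (N := 1) (ι := Set.Icc (0 : ℝ) 1) (fun _ t => t)
      fun _ t => t.2
    have : Infinite (Set.Icc (0 : ℝ) 1) := (Set.Icc_infinite zero_lt_one).to_subtype
    refine Infinite.of_injective (fun t => (p t : UniformSpace.Completion L)) fun s t hst => ?_
    have := h1 0 s t
    rw [UniformSpace.Completion.coe_injective L hst, dist_self] at this
    exact Subtype.ext (sub_eq_zero.1 (abs_nonpos_iff.1 this))
  have hle := weight_le_of_hasDense (le_max_right (weight G) ℵ₀) hdense.completion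
  refine ⟨UniformSpace.Completion L, inferInstance, inferInstance,
    hom.isOmegaHomogeneous_completion hL hd, hom.isUrysohn_completion hL hd,
    fun _ => ?_, fun _ => ?_,
    (toIsometryHom : G →* (UniformSpace.Completion L ≃ᵢ UniformSpace.Completion L)).range, ⟨?_⟩⟩
  · rw [max_eq_left (aleph0_le_weight G)] at hle
    exact hle.antisymm (weight_le_of_action (tendsto_smul_completion hc) hW')
  -- For finite `G` the lower bound comes from `M` being infinite.
  · rw [max_eq_right (weight_lt_aleph0 G).le] at hle
    exact hle.antisymm (aleph0_le_weight _)
  · have he := isEmbedding_toIsometryHom (tendsto_smul_completion hc) hW'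
    exact { MonoidHom.ofInjective he.injective with
      continuous_toFun := he.toHomeomorph.continuous
      continuous_invFun := he.toHomeomorph.symm.continuous.congr fun y => by
        obtain ⟨g, rfl⟩ := (MonoidHom.ofInjective he.injective).surjective y
        exact (he.toHomeomorph.symm_apply_apply g).trans
          ((MonoidHom.ofInjective he.injective).symm_apply_apply g).symm }
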